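/- Let $M$ be a nonsingular real $2\times2$ matrix and let $\mathbb T_M=\mathbb R^2/M\mathbb Z^2$ be the corresponding flat torus. Let $G$ be a finite graph (loops and parallel edges allowed) with a geodesic cellular embedding on $\mathbb T_M$: edges are projections of line segments, and all faces are open disks. Let $\widetilde G$ be its universal cover, an infinite straight-line plane graph that is periodic under $M\mathbb Z^2$. Given real weights $\pi_v$ on the vertices of $G$, let every lift $p$ of $v$ have weight $\pi_p=\pi_v$ and power function $\operatorname{pow}_p(x)=\tfrac12\|x-p\|^2-\pi_p$; the weighted Voronoi cell of $p$ is $\operatorname{Vor}(p)=\{x\in\mathbb R^2 : \operatorname{pow}_p(x)\le \operatorname{pow}_q(x)\text{ for all vertices } q \text{ of }\widetilde G\}$. We call $G$ the *weighted Delaunay graph* of its vertices with respect to $\pi$ if $\widetilde G$ is the weighted Delaunay graph of its vertex set, that is: for every vertex $p$ of $\widetilde G$ some point $x$ has $\operatorname{pow}_p(x)<\operatorname{pow}_r(x)$ for all vertices $r\neq p$; and distinct vertices $p,q$ of $\widetilde G$ are joined by an edge if and only if some point $x$ has $\operatorname{pow}_p(x)=\operatorname{pow}_q(x)<\operatorname{pow}_r(x)$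 for all vertices $r\ne p,q$. We call $G$ *coherent* if this holds for some weights $\pi$. A *dual geodesic drawing* $G^*$ of $G$ on $\mathbb T_M$ is a geodesic drawing of the dual graph homotopic to its natural embedding; equivalently, it is given by points $f^*\in\mathbb R^2$ for the faces $f$ of $\widetilde G$ with $(f+\gamma)^*=f^*+\gamma$ for $\gamma\in M\mathbb Z^2$, the dual $e^*$ of an edge $e$ of $\widetilde G$ being the segment between the points of the two faces on either side of $e$. $G$ is *reciprocal* if it has a dual geodesic drawing that is a cellular embedding and in which every edge $e$ of $G$ is orthogonal to $e^*$. A dual geodesic drawing is the *weighted Voronoi diagram* of the vertices of $G$ with weights $\pi$ if, in the universal cover, for every face $f$ the point $f^*$ lies in $\operatorname{Vor}(p)$ exactly for the vertices $p$ in the closure of $f$; $e^*=\operatorname{Vor}(p)\cap\operatorname{Vor}(q)$ for every edge $e=pq$; and the union of all dual edges is the set of points that lie in at least two cells. **Lemma.** Suppose that $G$ is the weighted Delaunay graph of its vertices with respect to the weights $\pi$. Then exactly one dual geodesic drawing $G^*$ of $G$ on $\mathbb T_M$ (given as a lift, i.e. as an assignment $f\mapsto f^*$) is the weighted Voronoi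 diagram of the vertices of $G$ with weights $\pi$; this $G^*$ is a cellular embedding, and every edge $e$ of $G$ is orthogonal to its dual edge $e^*$. Consequently, every coherent torus graph is reciprocal. -/

import Mathlib

open Set Filter Topology
open scoped Matrix

noncomputable section

namespace FlatTorus

/-- The Euclidean plane, the universal cover of every flat torus. -/
abbrev Plane : Type := EuclideanSpace ℝ (Fin 2)

/-- The group of deck transformations, in coordinates. -/
abbrev Z2 : Type := Fin 2 → ℤ

/-- Counterclockwise rotation by a right angle. -/
def rot (v : Plane) : Plane := !₂[-(v 1), v 0]

/-- The lattice vector `M k`; the flat torus of `M` is the quotient of the plane by the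
translations by these vectors. -/
def period (M : Matrix (Fin 2) (Fin 2) ℝ) (k : Z2) : Plane :=
  WithLp.toLp 2 (M *ᵥ fun i => (k i : ℝ))

/-! ### Straight-line drawings in the plane -/

/-- A straight-line drawing in the plane of a (possibly infinite) graph with vertex type `A` and
dart type `B`; `rev` exchanges the two darts of an edge. -/
structure LineDrawing (A B : Type*) where
  pos : A → Plane
  tail : B → A
  rev : B → B

namespace LineDrawing

variable {A B : Type*} (Γ : LineDrawing A B)

/-- The head of a dart. -/
def head (b : B) : A := Γ.tail (Γ.rev b)

/-- The displacement vector of a dart. -/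
def disp (b : B) : Plane := Γ.pos (Γ.head b) - Γ.pos (Γ.tail b)

/-- The closed segment that represents the edge of a dart. -/
def edge (b : B) : Set Plane := segment ℝ (Γ.pos (Γ.tail b)) (Γ.pos (Γ.head b))

/-- The relative interior of an edge. -/
def openEdge (b : B) : Set Plane := openSegment ℝ (Γ.pos (Γ.tail b)) (Γ.pos (Γ.head b))

/-- The subset of the plane covered by the drawing. -/
def support : Set Plane := range Γ.pos ∪ ⋃ b, Γ.edge b

/-- The drawing is injective: distinct vertices are distinct points, no vertex lies inside an
edge, and distinct edges have disjoint interiors. -/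
structure IsEmbedding : Prop where
  pos_injective : Function.Injective Γ.pos
  vertex_notMem : ∀ a b, Γ.pos a ∉ Γ.openEdge b
  edge_disjoint : ∀ b b', (Γ.openEdge b ∩ Γ.openEdge b').Nonempty → b' = b ∨ b' = Γ.rev b

/-- The faces are the connected components of the complement of the drawing. -/
def IsFace (F : Set Plane) : Prop :=
  ∃ x ∈ Γ.supportᶜ, F = connectedComponentIn Γ.supportᶜ x

/-- The type of faces. -/
def Face : Type := {F : Set Plane // Γ.IsFace F}

/-- `F` is the face immediately to the left of the dart `b`. -/
def IsLeftFace (F : Set Plane) (b : B) : Prop :=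
  ∀ᶠ ε : ℝ in 𝓝[>] 0,
    midpoint ℝ (Γ.pos (Γ.tail b)) (Γ.pos (Γ.head b)) + ε • rot (Γ.disp b) ∈ F

/-- For a drawing that is periodic with respect to the lattice of `M`: every face of the projected
drawing on the flat torus is an open disk. A face `F` of the periodic drawing projects onto a
face of the drawing on the torus, and this projection is the quotient of `F` by the translations
that preserve `F`; hence the face on the torus is an open disk if and only if `F` is one and only
the trivial translation preserves it. -/
def IsCellular (M : Matrix (Fin 2) (Fin 2) ℝ) : Prop :=
  ∀ F, Γ.IsFace F →
    Nonempty (F ≃ₜ Metric.ball (0 : Plane) 1) ∧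
      ∀ k : Z2, (fun x => x + period M k) '' F = F → k = 0

end LineDrawing

/-! ### Geodesic graphs on a flat torus -/

/-- A geodesic drawing of a graph (loops and parallel edges allowed) on the flat torus of `M`,
in its coordinate representation: a lift `coord v` of every vertex, and an integer homology
vector for every dart. The lift of the dart `d` that starts at `coord (tail d)` ends at
`coord (tail (rev d)) + M (hom d)`. -/
structure GeodesicDrawing (M : Matrix (Fin 2) (Fin 2) ℝ) (V D : Type*) where
  tail : D → V
  rev : D → D
  rev_rev : ∀ d, rev (rev d) = d
  rev_ne : ∀ d, rev d ≠ d
  coord : V → Plane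
  hom : D → Z2
  hom_rev : ∀ d, hom (rev d) = -hom d

namespace GeodesicDrawing

variable {M : Matrix (Fin 2) (Fin 2) ℝ} {V D : Type*} (G : GeodesicDrawing M V D)

/-- The universal cover: the lift of `v` or of `d` with index `k` is the base lift translated
by `M k`. -/
def cover : LineDrawing (V × Z2) (D × Z2) where
  pos a := G.coord a.1 + period M a.2
  tail b := (G.tail b.1, b.2)
  rev b := (G.rev b.1, b.2 + G.hom b.1)

/-- `G` is a geodesic torus graph: the drawing on the torus is a cellular embedding. -/
def IsTorusGraph : Prop := G.cover.IsEmbedding ∧ G.cover.IsCellular M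

/-! ### Weighted Voronoi diagrams and weighted Delaunay graphs -/

/-- The (halved) power distance from the point `x` to the lift `a` of a vertex, where all lifts of
a vertex `v` have the same weight `π v`. -/
def power (π : V → ℝ) (a : V × Z2) (x : Plane) : ℝ :=
  ‖x - G.cover.pos a‖ ^ 2 / 2 - π a.1

/-- The weighted Voronoi cell (power cell) of a lifted vertex, among all lifted vertices. -/
def cell (π : V → ℝ) (a : V × Z2) : Set Plane :=
  {x | ∀ c, G.power π a x ≤ G.power π c x}

/-- `G` is the weighted Delaunay graph of its vertices with respect to the weights `π`: its
universal cover is the weighted Delaunay graph of the set of all lifted vertices. That is, every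
lifted vertex is strictly nearest (in power distance) to some point of the plane, and two lifted
vertices are joined by a lifted edge exactly when they are the two nearest lifted vertices,
at equal power distance, of some point from which all the others are strictly farther.
In terms of the heights `‖p‖ ^ 2 / 2 - π p`: the lifted vertices and edges are the vertices and
edges of the lower convex hull. -/
structure IsWeightedDelaunay (π : V → ℝ) : Prop where
  vertex : ∀ a, ∃ x, ∀ c, c ≠ a → G.power π a x < G.power π c x
  edge : ∀ a b, a ≠ b →
    ((∃ e, G.cover.tail e = a ∧ G.cover.head e = b) ↔
      ∃ x, G.power π a x = G.power π b x ∧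
        ∀ c, c ≠ a → c ≠ b → G.power π a x < G.power π c x)

/-- `G` is coherent: a weighted Delaunay graph for some vertex weights. -/
def IsCoherent : Prop := ∃ π : V → ℝ, G.IsWeightedDelaunay π

/-! ### Dual drawings and reciprocal diagrams -/

/-- A geodesic drawing, on the same torus, of the dual graph of `G`, homotopic to the natural
embedding of the dual graph. It is given by its lift to the plane: a point `pos F` for every face
`F` of the universal cover of `G`, compatible with the translations by lattice vectors, the dual
of a dart going straight from the point of its right face to the point of its left face.
(The drawings homotopic to the natural one are exactly those whose lift, indexed by the faces of
the universal cover, is compatible with translations.) -/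
@[ext]
structure DualDrawing where
  pos : G.cover.Face → Plane
  left : D × Z2 → G.cover.Face
  isLeftFace_left : ∀ b, G.cover.IsLeftFace (left b).1 b
  pos_translate : ∀ (F F' : G.cover.Face) (k : Z2),
    F'.1 = (fun x => x + period M k) '' F.1 → pos F' = pos F + period M k

namespace DualDrawing

variable {G} (S : G.DualDrawing)

/-- The lift of the dual drawing to the plane. The dual of a dart has the right face of the dart
as its tail and the left face of the dart as its head. -/
def cover : LineDrawing G.cover.Face (D × Z2) where
  pos := S.pos
  tail b := S.left (G.cover.rev b)
  rev := G.cover.rev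

/-- Every edge of `G` is orthogonal to its dual edge. -/
def IsOrthogonal : Prop := ∀ b, inner ℝ (G.cover.disp b) (S.cover.disp b) = 0

/-- The dual drawing is a (cellular) geodesic embedding. -/
def IsDualEmbedding : Prop := S.cover.IsEmbedding ∧ S.cover.IsCellular M

/-- The dual drawing is the weighted Voronoi diagram of the vertices of `G` with weights `π`:
its vertex for the face `F` lies in the Voronoi cells of exactly the vertices of `F`,
the dual of each edge is the common part of the Voronoi cells of the endpoints of the edge, and
the dual edges together make up all points that lie in at least two Voronoi cells. -/
structure IsWeightedVoronoi (π : V → ℝ) : Prop where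
  vertex : ∀ (F : G.cover.Face) (a : V × Z2),
    S.pos F ∈ G.cell π a ↔ G.cover.pos a ∈ closure F.1
  edge : ∀ b, S.cover.edge b = G.cell π (G.cover.tail b) ∩ G.cell π (G.cover.head b)
  skeleton : (⋃ b, S.cover.edge b) = {x | ∃ a c, a ≠ c ∧ x ∈ G.cell π a ∩ G.cell π c}

end DualDrawing

/-- `G` is reciprocal: its dual graph has a geodesic embedding on the same torus in which every
edge of `G` is orthogonal to its dual edge. -/
def IsReciprocal : Prop := ∃ S : G.DualDrawing, S.IsDualEmbedding ∧ S.IsOrthogonal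

end GeodesicDrawing

end FlatTorus

end

namespace FlatTorus

/-! ### The plane -/

/-! The proof is convex duality. Since `pow_a x = ‖x‖² / 2 - height a x` with `height a` affine of
gradient `p a`, the power diagram is the partition of the plane by which affine functions attain the
upper envelope: `x` lies in the cell of `a` iff `a ∈ active x`. The set `activeHull x`, spanned by
the active gradients, is the subdifferential of the envelope at `x`.

Monotonicity of subgradients drives everything. A point interior to `activeHull x` lies in no other
hull (`eq_of_mem_interior_activeHull`), and two hulls meet only in the hull of their common
gradients (`mem_convexHull_inter`). Every point of the plane lies in some hull, because the envelope
grows quadratically (`exists_mem_activeHull`). Because every vertex is strictly nearest somewhere,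
active gradients are in convex position. The hulls with at most two gradients therefore form the
Delaunay drawing, and its faces are the interiors of the hulls with more than two (`isFace_iff`). So
each face `F` determines exactly one point `x` with `F = interior (activeHull x)`, and this point
must be `F^*`.

The dual edge of `pq` is the set where `p` and `q` are both active. Along it the two affine
functions agree, which makes it orthogonal to `p - q`. Its two ends are the extreme points in the
directions `± rot (q - p)`, and these are the dual points of the left and right faces
(`exists_last`, `edge_eq`). The complement of the dual drawing consists of the sets where a single
function is active; these are bounded, open and convex, hence disks. -/

theorem inner_eq (v w : Plane) : inner ℝ v w = v 0 * w 0 + v 1 * w 1 := by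
  simp [PiLp.inner_apply, Fin.sum_univ_two, mul_comm]

theorem inner_rot_self (v : Plane) : inner ℝ v (rot v) = 0 := by
  simp [inner_eq, rot]; ring

theorem rot_ne_zero {v : Plane} (hv : v ≠ 0) : rot v ≠ 0 := by
  contrapose! hv
  have h0 := congrArg (fun w : Plane => w 0) hv
  have h1 := congrArg (fun w : Plane => w 1) hv
  ext i
  fin_cases i <;> simp_all [rot]

theorem rot_neg (v : Plane) : rot (-v) = -rot v := by
  ext i
  fin_cases i <;> simp [rot]

theorem eq_smul_rot {z v : Plane} (hz : z ≠ 0) (h : inner ℝ v z = 0) :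
    ∃ c : ℝ, v = c • rot z := by
  have hpos : z 0 * z 0 + z 1 * z 1 ≠ 0 := by
    rw [← inner_eq]
    exact inner_self_ne_zero.2 hz
  rw [inner_eq] at h
  refine ⟨(v 1 * z 0 - v 0 * z 1) / (z 0 * z 0 + z 1 * z 1), ?_⟩
  ext i
  fin_cases i
  · change v 0 = _ / _ * -(z 1)
    rw [div_mul_eq_mul_div, eq_div_iff hpos]
    linear_combination z 0 * h
  · change v 1 = _ / _ * z 0
    rw [div_mul_eq_mul_div, eq_div_iff hpos]
    linear_combination z 1 * h

theorem eq_smul_add_smul_rot {u : Plane} (hu : u ≠ 0) (v : Plane) :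
    ∃ c : ℝ, v = c • u + (inner ℝ v (rot u) / inner ℝ u u : ℝ) • rot u := by
  have hpos : u 0 * u 0 + u 1 * u 1 ≠ 0 := by
    rw [← inner_eq]
    exact inner_self_ne_zero.2 hu
  refine ⟨(v 0 * u 0 + v 1 * u 1) / (u 0 * u 0 + u 1 * u 1), ?_⟩
  ext i
  fin_cases i
  · change v 0 = _ / _ * u 0 + inner ℝ v (rot u) / inner ℝ u u * -(u 1)
    rw [inner_eq u u, div_mul_eq_mul_div, div_mul_eq_mul_div, ← add_div, eq_div_iff hpos, inner_eq]
    simp [rot]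
    ring
  · change v 1 = _ / _ * u 1 + inner ℝ v (rot u) / inner ℝ u u * u 0
    rw [inner_eq u u, div_mul_eq_mul_div, div_mul_eq_mul_div, ← add_div, eq_div_iff hpos, inner_eq]
    simp [rot]
    ring

/-! ### Convex hulls and linear functionals -/

theorem inner_le_of_mem_convexHull {T : Set Plane} {z : Plane} {s : ℝ}
    (h : ∀ t ∈ T, inner ℝ t z ≤ s) {y : Plane} (hy : y ∈ convexHull ℝ T) : inner ℝ y z ≤ s := by
  have hc : Convex ℝ {y : Plane | inner ℝ y z ≤ s} := by
    have := convex_halfSpace_le (𝕜 := ℝ) (f := fun y : Plane => inner ℝ y z)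
      ⟨fun x y => inner_add_left x y z, fun c x => by simp [inner_smul_left]⟩ s
    exact this
  exact convexHull_min h hc hy

theorem inner_lt_of_mem_convexHull {T : Set Plane} {z : Plane} {s : ℝ}
    (h : ∀ t ∈ T, inner ℝ t z < s) {y : Plane} (hy : y ∈ convexHull ℝ T) : inner ℝ y z < s := by
  have hc : Convex ℝ {y : Plane | inner ℝ y z < s} := by
    have := convex_halfSpace_lt (𝕜 := ℝ) (f := fun y : Plane => inner ℝ y z)
      ⟨fun x y => inner_add_left x y z, fun c x => by simp [inner_smul_left]⟩ s
    exact this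
  exact convexHull_min h hc hy

/-- A point of a convex hull that maximizes a linear functional lies in the convex hull of the
generators that maximize it. -/
theorem mem_convexHull_of_isMax {T : Set Plane} {z y : Plane} (hy : y ∈ convexHull ℝ T)
    (h : ∀ t ∈ T, inner ℝ t z ≤ (inner ℝ y z : ℝ)) :
    y ∈ convexHull ℝ {t ∈ T | (inner ℝ t z : ℝ) = inner ℝ y z} := by
  set s : ℝ := inner ℝ y z with hs
  have heq : ∀ w ∈ convexHull ℝ {t ∈ T | (inner ℝ t z : ℝ) = s}, inner ℝ w z = s := by
    intro w hw
    refine le_antisymm (inner_le_of_mem_convexHull (fun t ht => ht.2.le) hw) ?_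
    have := inner_le_of_mem_convexHull (z := -z) (s := -s)
      (fun t ht => by rw [inner_neg_right, ht.2]) hw
    rw [inner_neg_right] at this
    linarith
  -- The open half-plane together with the hull of the maximizers is convex and contains `T`, hence
  -- also `y`; but `y` is not in the half-plane.
  have hc : Convex ℝ ({w : Plane | inner ℝ w z < s} ∪
      convexHull ℝ {t ∈ T | (inner ℝ t z : ℝ) = s}) := by
    refine convex_iff_forall_pos.2 fun w hw w' hw' a b ha hb hab => ?_
    have hval : (inner ℝ (a • w + b • w') z : ℝ) = a * inner ℝ w z + b * inner ℝ w' z := by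
      simp [inner_add_left, inner_smul_left]
    have hle : ∀ v ∈ ({w : Plane | inner ℝ w z < s} ∪
        convexHull ℝ {t ∈ T | (inner ℝ t z : ℝ) = s}), inner ℝ v z ≤ s := by
      rintro v (hv | hv)
      · exact le_of_lt hv
      · exact (heq v hv).le
    rcases hw with hw | hw
    · left
      have h1 : inner ℝ w z < s := hw
      have h2 := hle w' hw'
      change inner ℝ (a • w + b • w') z < s
      rw [hval]
      have : s = a * s + b * s := by rw [← add_mul, hab, one_mul]
      nlinarith
    · rcases hw' with hw' | hw'
      · left
        have h1 : inner ℝ w' z < s := hw'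
        have h2 := (heq w hw).le
        change inner ℝ (a • w + b • w') z < s
        rw [hval]
        have : s = a * s + b * s := by rw [← add_mul, hab, one_mul]
        nlinarith
      · right
        exact (convex_convexHull ℝ _) hw hw' ha.le hb.le hab
  have hsub : T ⊆ {w : Plane | inner ℝ w z < s} ∪
      convexHull ℝ {t ∈ T | (inner ℝ t z : ℝ) = s} := by
    intro t ht
    rcases (h t ht).lt_or_eq with hlt | he
    · exact Or.inl hlt
    · exact Or.inr (subset_convexHull ℝ _ ⟨ht, he⟩)
  rcases convexHull_min hsub hc hy with hlt | hmem
  · exact absurd hlt (lt_irrefl s)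
  · exact hmem

theorem exists_inner_eq (f : StrongDual ℝ Plane) : ∃ z : Plane, ∀ y, f y = inner ℝ y z := by
  refine ⟨(InnerProductSpace.toDual ℝ Plane).symm f, fun y => ?_⟩
  rw [real_inner_comm, InnerProductSpace.toDual_symm_apply]

/-- A supporting line at a point outside the interior of a convex set. -/
theorem exists_supporting {K : Set Plane} (hK : Convex ℝ K) (hi : (interior K).Nonempty)
    {y : Plane} (hy : y ∉ interior K) :
    ∃ z : Plane, z ≠ 0 ∧ ∀ w ∈ K, inner ℝ w z ≤ (inner ℝ y z : ℝ) := by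
  obtain ⟨f, hf⟩ := geometric_hahn_banach_open_point hK.interior isOpen_interior hy
  obtain ⟨z, hz⟩ := exists_inner_eq f
  refine ⟨z, ?_, fun w hw => ?_⟩
  · rintro rfl
    obtain ⟨o, ho⟩ := hi
    have := hf o ho
    simp [hz] at this
  · have hsub : closure (interior K) ⊆ {w | f w ≤ f y} :=
      closure_minimal (fun a ha => (hf a ha).le) (isClosed_le f.continuous continuous_const)
    have hw' : w ∈ closure (interior K) := by
      rw [hK.closure_interior_eq_closure_of_nonempty_interior hi]
      exact subset_closure hw
    have := hsub hw'
    simpa [hz] using this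

/-- A linear functional that attains its maximum over a set at an interior point vanishes. -/
theorem eq_zero_of_isMax_of_mem_interior {K : Set Plane} {y z : Plane} (hy : y ∈ interior K)
    (h : ∀ w ∈ K, inner ℝ w z ≤ (inner ℝ y z : ℝ)) : z = 0 := by
  have hcont : Tendsto (fun t : ℝ => y + t • z) (𝓝[>] 0) (𝓝 y) := by
    have : Continuous fun t : ℝ => y + t • z := by fun_prop
    simpa using (this.tendsto 0).mono_left nhdsWithin_le_nhds
  have hev := hcont.eventually (mem_interior_iff_mem_nhds.1 hy)
  obtain ⟨t, ht, htpos⟩ := (hev.and self_mem_nhdsWithin).exists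
  have h1 := h _ ht
  rw [inner_add_left, inner_smul_left] at h1
  have h2 : t * inner ℝ z z ≤ 0 := by simpa using h1
  have h3 : (inner ℝ z z : ℝ) ≤ 0 := nonpos_of_mul_nonpos_right h2 htpos
  exact inner_self_eq_zero.1 (le_antisymm h3 real_inner_self_nonneg)

/-- A convex set with empty interior spans a proper affine subspace, and a nonzero normal to that
subspace is constant on the set. -/
theorem interior_nonempty_of_inner_const {K : Set Plane} (hK : Convex ℝ K) (hne : K.Nonempty)
    (h : ∀ z : Plane, (∀ v ∈ K, ∀ w ∈ K, inner ℝ v z = (inner ℝ w z : ℝ)) → z = 0) :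
    (interior K).Nonempty := by
  rw [hK.interior_nonempty_iff_affineSpan_eq_top,
    ← AffineSubspace.direction_eq_top_iff_of_nonempty ((affineSpan_nonempty ℝ).2 hne),
    direction_affineSpan, ← Submodule.orthogonal_eq_bot_iff, Submodule.eq_bot_iff]
  intro z hz
  refine h z fun v hv w hw => ?_
  have := (Submodule.mem_orthogonal _ _).1 hz (v - w) (vsub_mem_vectorSpan ℝ hv hw)
  rw [inner_sub_left] at this
  linarith

/-- An open preconnected set whose complement in `X` is relatively open is a connected component
of `X`. -/
theorem connectedComponentIn_eq_of_isOpen {X U W : Set Plane} (hU : IsOpen U) (hW : IsOpen W)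
    (hUW : Disjoint U W) (hX : X ⊆ U ∪ W) (hUX : U ⊆ X) (hconn : IsPreconnected U)
    {x : Plane} (hx : x ∈ U) : connectedComponentIn X x = U := by
  refine Subset.antisymm ?_ (hconn.subset_connectedComponentIn hx hUX)
  exact IsPreconnected.subset_left_of_subset_union hU hW hUW
    ((connectedComponentIn_subset X x).trans hX)
    ⟨x, mem_connectedComponentIn (hUX hx), hx⟩ isPreconnected_connectedComponentIn

theorem nonempty_homeomorph_ball {K : Set Plane} (hK : Convex ℝ K) (hne : K.Nonempty)
    (ho : IsOpen K) (hb : Bornology.IsBounded K) :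
    Nonempty (K ≃ₜ Metric.ball (0 : Plane) 1) := by
  obtain ⟨e, he, -⟩ := exists_homeomorph_image_interior_closure_frontier_eq_unitBall hK
    (by rwa [ho.interior_eq]) hb
  rw [ho.interior_eq] at he
  exact ⟨(e.image K).trans (Homeomorph.setCongr he)⟩

/-! ### Upper envelopes of affine functions -/

section Envelope

variable {A : Type*} (p : A → Plane) (h : A → ℝ)

/-- The affine function with gradient `p a` and constant term `-h a`. -/
noncomputable def height (a : A) (x : Plane) : ℝ := inner ℝ (p a) x - h a

/-- The indices whose affine functions attain the upper envelope at `x`. -/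
def active (x : Plane) : Set A := {a | ∀ c, height p h c x ≤ height p h a x}

/-- The convex hull of the gradients of the affine functions that attain the upper envelope
at `x`. -/
def activeHull (x : Plane) : Set Plane := convexHull ℝ (p '' active p h x)

/-- The properties of the family of affine functions belonging to a periodic system of weighted
points in the plane: the upper envelope is attained by locally finitely many functions, over
bounded regions, its gradients cover the plane, and every function is the only one to attain the
envelope at some point. -/
structure IsRegularEnvelope : Prop where
  nonempty : ∀ x, (active p h x).Nonempty
  finite : ∀ x, (active p h x).Finite
  eventually_subset : ∀ x, ∀ᶠ y in 𝓝 x, active p h y ⊆ active p h x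
  bounded : ∀ a, Bornology.IsBounded {x | a ∈ active p h x}
  cover : ∀ y, ∃ x, y ∈ activeHull p h x
  vertex : ∀ a, ∃ x, active p h x = {a}

variable {p h}

theorem height_add (a : A) (x z : Plane) :
    height p h a (x + z) = height p h a x + inner ℝ (p a) z := by
  simp only [height, inner_add_right]; ring

theorem height_sub_height (a : A) (x y : Plane) :
    height p h a y - height p h a x = inner ℝ (p a) (y - x) := by
  simp only [height, inner_sub_right]; ring

theorem continuous_height (a : A) : Continuous (height p h a) := by
  unfold height; fun_prop

theorem height_eq_of_active {a b : A} {x : Plane} (ha : a ∈ active p h x)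
    (hb : b ∈ active p h x) : height p h a x = height p h b x :=
  le_antisymm (hb a) (ha b)

theorem mem_active_of_height_eq {a b : A} {x : Plane} (ha : a ∈ active p h x)
    (hb : height p h b x = height p h a x) : b ∈ active p h x :=
  fun c => (ha c).trans_eq hb.symm

theorem height_lt_of_notMem_active {a b : A} {x : Plane} (ha : a ∈ active p h x)
    (hb : b ∉ active p h x) : height p h b x < height p h a x :=
  lt_of_le_of_ne (ha b) fun he => hb (mem_active_of_height_eq ha he)

theorem isClosed_setOf_mem_active (a : A) : IsClosed {x | a ∈ active p h x} := by
  have : {x | a ∈ active p h x} = ⋂ c, {x | height p h c x ≤ height p h a x} := by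
    ext x; simp [active]
  rw [this]
  exact isClosed_iInter fun c => isClosed_le (continuous_height c) (continuous_height a)

theorem height_combo (a : A) (x y : Plane) {s t : ℝ} (hst : s + t = 1) :
    height p h a (s • x + t • y) = s * height p h a x + t * height p h a y := by
  simp only [height, inner_add_right, inner_smul_right]
  linear_combination h a * hst

theorem convex_setOf_mem_active (a : A) : Convex ℝ {x | a ∈ active p h x} := by
  intro x hx y hy s t hs ht hst c
  rw [height_combo _ _ _ hst, height_combo _ _ _ hst]
  exact add_le_add (mul_le_mul_of_nonneg_left (hx c) hs) (mul_le_mul_of_nonneg_left (hy c) ht)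

theorem convex_activeHull (x : Plane) : Convex ℝ (activeHull p h x) := convex_convexHull ℝ _

theorem mem_activeHull {a : A} {x : Plane} (ha : a ∈ active p h x) : p a ∈ activeHull p h x :=
  subset_convexHull ℝ _ ⟨a, ha, rfl⟩

/-- Monotonicity of the gradients. -/
theorem inner_le_inner_of_active {a c : A} {x x' : Plane} (ha : a ∈ active p h x)
    (hc : c ∈ active p h x') :
    (inner ℝ (p a) (x' - x) : ℝ) ≤ inner ℝ (p c) (x' - x) := by
  have h1 := ha c
  have h2 := hc a
  have h3 := height_sub_height (p := p) (h := h) a x x'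
  have h4 := height_sub_height (p := p) (h := h) c x x'
  linarith

theorem mem_active_of_inner_eq {a c : A} {x x' : Plane} (ha : a ∈ active p h x)
    (hc : c ∈ active p h x')
    (he : (inner ℝ (p a) (x' - x) : ℝ) = inner ℝ (p c) (x' - x)) : a ∈ active p h x' := by
  have h1 := ha c
  have h2 := hc a
  have h3 := height_sub_height (p := p) (h := h) a x x'
  have h4 := height_sub_height (p := p) (h := h) c x x'
  exact mem_active_of_height_eq hc (by linarith)

/-- By monotonicity, the functional of `x' - x` is at most its value at `y` on the hull of `x` and
at least that value on the hull of `x'`. So `y` is a combination of maximizing gradients at `x`, and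
each of these ties with a minimizing gradient at `x'`, which makes it active there too. -/
theorem mem_convexHull_inter {x x' y : Plane} (hy : y ∈ activeHull p h x)
    (hy' : y ∈ activeHull p h x') :
    y ∈ convexHull ℝ (p '' (active p h x ∩ active p h x')) := by
  set z := x' - x with hz
  have hle : ∀ c ∈ active p h x', (inner ℝ y z : ℝ) ≤ inner ℝ (p c) z := fun c hc =>
    inner_le_of_mem_convexHull (by
      rintro _ ⟨a, ha, rfl⟩
      exact inner_le_inner_of_active ha hc) hy
  have hge : ∀ a ∈ active p h x, (inner ℝ (p a) z : ℝ) ≤ inner ℝ y z := fun a ha => by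
    have := inner_le_of_mem_convexHull (z := -z) (s := -inner ℝ (p a) z) (by
      rintro _ ⟨c, hc, rfl⟩
      rw [inner_neg_right, neg_le_neg_iff]
      exact inner_le_inner_of_active ha hc) hy'
    rw [inner_neg_right] at this
    linarith
  obtain ⟨c, hc, hce⟩ : ∃ c ∈ active p h x', (inner ℝ (p c) z : ℝ) = inner ℝ y z := by
    have hmem := mem_convexHull_of_isMax (z := -z) hy' (by
      rintro _ ⟨c, hc, rfl⟩
      rw [inner_neg_right, inner_neg_right, neg_le_neg_iff]
      exact hle c hc)
    obtain ⟨t, ⟨c, hc, rfl⟩, ht⟩ := convexHull_nonempty_iff.1 ⟨y, hmem⟩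
    rw [inner_neg_right, inner_neg_right, neg_inj] at ht
    exact ⟨c, hc, ht⟩
  refine convexHull_mono ?_ (mem_convexHull_of_isMax (z := z) hy (by
    rintro _ ⟨a, ha, rfl⟩
    exact hge a ha))
  rintro _ ⟨⟨a, ha, rfl⟩, hae⟩
  exact ⟨a, ⟨ha, mem_active_of_inner_eq ha hc (hae.trans hce.symm)⟩, rfl⟩

/-- At every point, some direction increases a given function faster than
the other active functions. -/
theorem IsRegularEnvelope.exists_inner_lt (H : IsRegularEnvelope p h) (a : A) (x : Plane) :
    ∃ z : Plane, ∀ c ∈ active p h x, c ≠ a → (inner ℝ (p c) z : ℝ) < inner ℝ (p a) z := by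
  obtain ⟨x', hx'⟩ := H.vertex a
  have ha' : a ∈ active p h x' := by rw [hx']; rfl
  refine ⟨x' - x, fun c hc hca => lt_of_le_of_ne (inner_le_inner_of_active hc ha') fun he => hca ?_⟩
  have := mem_active_of_inner_eq hc ha' he
  rwa [hx'] at this

/-- The gradients of the active functions are in convex position. -/
theorem IsRegularEnvelope.mem_of_mem_convexHull (H : IsRegularEnvelope p h) {a : A} {x : Plane}
    {T : Set A} (hT : T ⊆ active p h x)
    (hmem : p a ∈ convexHull ℝ (p '' T)) : a ∈ T := by
  by_contra hn
  obtain ⟨z, hz⟩ := H.exists_inner_lt a x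
  refine lt_irrefl _ (inner_lt_of_mem_convexHull (s := inner ℝ (p a) z) ?_ hmem)
  rintro _ ⟨c, hc, rfl⟩
  exact hz c (hT hc) fun e => hn (e ▸ hc)

theorem IsRegularEnvelope.eq_of_eq (H : IsRegularEnvelope p h) {a b : A} (he : p a = p b) :
    a = b := by
  obtain ⟨x, hx⟩ := H.vertex a
  obtain ⟨y, hy⟩ := H.vertex b
  have ha : a ∈ active p h x := by rw [hx]; rfl
  have hb : b ∈ active p h y := by rw [hy]; rfl
  have := mem_active_of_inner_eq ha hb (by rw [he])
  rwa [hy] at this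

theorem IsRegularEnvelope.eq_or_eq_of_wbtw (H : IsRegularEnvelope p h) {a b c : A} {x : Plane}
    (ha : a ∈ active p h x) (hc : c ∈ active p h x)
    (hw : Wbtw ℝ (p a) (p b) (p c)) : b = a ∨ b = c := by
  have hmem : p b ∈ convexHull ℝ (p '' {a, c}) := by
    rw [image_pair, convexHull_pair]
    exact mem_segment_iff_wbtw.2 hw
  have := H.mem_of_mem_convexHull (T := {a, c}) (by rintro _ (rfl | rfl) <;> assumption) hmem
  simpa using this

/-- No linear functional other than zero takes the same value at three active gradients. -/
theorem IsRegularEnvelope.eq_zero_of_inner_eq (H : IsRegularEnvelope p h) {a b c : A}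
    {x z : Plane} (ha : a ∈ active p h x) (hb : b ∈ active p h x) (hc : c ∈ active p h x)
    (hab : a ≠ b) (hac : a ≠ c) (hbc : b ≠ c)
    (h1 : (inner ℝ (p b) z : ℝ) = inner ℝ (p a) z)
    (h2 : (inner ℝ (p c) z : ℝ) = inner ℝ (p a) z) : z = 0 := by
  by_contra hz
  -- If `z ≠ 0`, all three gradients lie on a line of direction `rot z`; the middle one then
  -- contradicts convex position.
  obtain ⟨s, hs⟩ := eq_smul_rot (v := p b - p a) hz (by rw [inner_sub_left, h1, sub_self])
  obtain ⟨t, ht⟩ := eq_smul_rot (v := p c - p a) hz (by rw [inner_sub_left, h2, sub_self])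
  have hcol : Collinear ℝ {p a, p b, p c} := by
    refine (collinear_iff_of_mem (p₀ := p a) (by simp)).2 ⟨rot z, ?_⟩
    rintro q (rfl | rfl | rfl)
    · exact ⟨0, by simp⟩
    · exact ⟨s, by rw [← hs]; simp⟩
    · exact ⟨t, by rw [← ht]; simp⟩
  rcases hcol.wbtw_or_wbtw_or_wbtw with hw | hw | hw
  · rcases H.eq_or_eq_of_wbtw ha hc hw with e | e
    · exact hab e.symm
    · exact hbc e
  · rcases H.eq_or_eq_of_wbtw hb ha hw with e | e
    · exact hbc e.symm
    · exact hac e.symm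
  · rcases H.eq_or_eq_of_wbtw hc hb hw with e | e
    · exact hac e
    · exact hab e

/-- Moving a little in the direction `z` leaves active exactly those functions that grow fastest
in this direction. -/
theorem IsRegularEnvelope.exists_active_add_smul (H : IsRegularEnvelope p h) (x z : Plane) :
    ∃ ε : ℝ, 0 < ε ∧ active p h (x + ε • z) =
      {a ∈ active p h x | ∀ c ∈ active p h x, (inner ℝ (p c) z : ℝ) ≤ inner ℝ (p a) z} := by
  have hcont : Tendsto (fun t : ℝ => x + t • z) (𝓝[>] 0) (𝓝 x) := by
    have : Continuous fun t : ℝ => x + t • z := by fun_prop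
    simpa using (this.tendsto 0).mono_left nhdsWithin_le_nhds
  -- For such a small step no function inactive at `x` becomes active; among the active ones, which
  -- agree at `x`, only the rate of growth decides.
  obtain ⟨ε, hsub, hε⟩ :=
    ((hcont.eventually (H.eventually_subset x)).and self_mem_nhdsWithin).exists
  have hε : 0 < ε := hε
  have hval : ∀ a, height p h a (x + ε • z) = height p h a x + ε * inner ℝ (p a) z := fun a => by
    rw [height_add, inner_smul_right]
  refine ⟨ε, hε, Subset.antisymm (fun a ha => ⟨hsub ha, fun c hc => ?_⟩) ?_⟩
  · have h1 := ha c
    rw [hval, hval, height_eq_of_active hc (hsub ha)] at h1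
    exact le_of_mul_le_mul_left (by linarith) hε
  · rintro a ⟨ha, hmax⟩
    obtain ⟨b, hb⟩ := H.nonempty (x + ε • z)
    refine mem_active_of_height_eq hb (le_antisymm (hb a) ?_)
    rw [hval, hval, height_eq_of_active (hsub hb) ha]
    have := mul_le_mul_of_nonneg_left (hmax b (hsub hb)) hε.le
    linarith

/-- An affine function that vanishes on the envelope inside a segment on which another function
is active is active on the whole segment. -/
theorem mem_active_of_mem_openSegment {a c : A} {x y w : Plane} (hx : a ∈ active p h x)
    (hy : a ∈ active p h y) (hw : w ∈ openSegment ℝ x y) (hc : c ∈ active p h w) :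
    c ∈ active p h x ∧ c ∈ active p h y := by
  obtain ⟨s, t, hs, ht, hst, rfl⟩ := hw
  have h1 := hc a
  rw [height_combo _ _ _ hst, height_combo _ _ _ hst] at h1
  have h2 := mul_le_mul_of_nonneg_left (hx c) hs.le
  have h3 := mul_le_mul_of_nonneg_left (hy c) ht.le
  refine ⟨mem_active_of_height_eq hx (le_antisymm (hx c) ?_),
    mem_active_of_height_eq hy (le_antisymm (hy c) ?_)⟩
  · exact le_of_mul_le_mul_left (by linarith) hs
  · exact le_of_mul_le_mul_left (by linarith) ht

end Envelope

/-! ### The tiling of the plane by hulls of active gradients, and the dual cells. -/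

section Envelope

variable {A : Type*} {p : A → Plane} {h : A → ℝ}

variable (p h) in
/-- The union of the convex hulls of at most two active gradients. -/
def hullSkeleton : Set Plane := {y | ∃ x, (active p h x).ncard ≤ 2 ∧ y ∈ activeHull p h x}

theorem inner_le_inner_of_mem_activeHull {x x' w y : Plane} (hw : w ∈ activeHull p h x)
    (hy : y ∈ activeHull p h x') : (inner ℝ w (x' - x) : ℝ) ≤ inner ℝ y (x' - x) := by
  refine inner_le_of_mem_convexHull ?_ hw
  rintro _ ⟨a, ha, rfl⟩
  have := inner_le_of_mem_convexHull (z := -(x' - x)) (s := -inner ℝ (p a) (x' - x)) (by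
    rintro _ ⟨c, hc, rfl⟩
    rw [inner_neg_right, neg_le_neg_iff]
    exact inner_le_inner_of_active ha hc) hy
  rw [inner_neg_right] at this
  linarith

/-- The difference of two functions active at both points vanishes at both. This is the
orthogonality of an edge and its dual. -/
theorem inner_sub_sub_eq_zero {a b : A} {x w : Plane} (hxa : a ∈ active p h x)
    (hxb : b ∈ active p h x) (hwa : a ∈ active p h w) (hwb : b ∈ active p h w) :
    (inner ℝ (p b - p a) (w - x) : ℝ) = 0 := by
  rw [inner_sub_left]
  have h1 := height_sub_height (p := p) (h := h) a x w
  have h2 := height_sub_height (p := p) (h := h) b x w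
  have h3 := height_eq_of_active hxa hxb
  have h4 := height_eq_of_active hwa hwb
  linarith

/-- By monotonicity, the functional of `x' - x` attains its maximum over the hull of `x` at the
interior point `y`, so it vanishes. This gives uniqueness of dual points. -/
theorem eq_of_mem_interior_activeHull {x x' y : Plane} (hy : y ∈ interior (activeHull p h x))
    (hy' : y ∈ activeHull p h x') : x' = x :=
  sub_eq_zero.1 <| eq_zero_of_isMax_of_mem_interior hy
    fun _ hw => inner_le_inner_of_mem_activeHull hw hy'

theorem convex_setOf_active_eq (a : A) : Convex ℝ {x | active p h x = {a}} := by
  refine convex_iff_openSegment_subset.2 fun x hx y hy w hw => ?_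
  have hxa : a ∈ active p h x := by rw [show active p h x = {a} from hx]; rfl
  have hya : a ∈ active p h y := by rw [show active p h y = {a} from hy]; rfl
  refine Subset.antisymm (fun c hc => ?_) (singleton_subset_iff.2 ?_)
  · have := (mem_active_of_mem_openSegment hxa hya hw hc).1
    rwa [show active p h x = {a} from hx] at this
  · exact (convex_setOf_mem_active a).openSegment_subset hxa hya hw

theorem notMem_hullSkeleton {x y : Plane}
    (hx : 2 < (active p h x).ncard) (hy : y ∈ interior (activeHull p h x)) :
    y ∉ hullSkeleton p h := by
  rintro ⟨x', hx', hy'⟩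
  rw [eq_of_mem_interior_activeHull hy hy'] at hx'
  omega

namespace IsRegularEnvelope

/-- Compare with a point where `a` alone is active: the common gradients span `p a`, so `a` is among
them. -/
theorem mem_activeHull_iff (H : IsRegularEnvelope p h) {a : A} {x : Plane} :
    p a ∈ activeHull p h x ↔ a ∈ active p h x := by
  refine ⟨fun ha => ?_, mem_activeHull⟩
  obtain ⟨x', hx'⟩ := H.vertex a
  have ha' : a ∈ active p h x' := by rw [hx']; rfl
  exact (H.mem_of_mem_convexHull inter_subset_right
    (mem_convexHull_inter ha (mem_activeHull ha'))).1

theorem eq_zero_of_forall_inner_eq (H : IsRegularEnvelope p h) {x z : Plane} {T : Set A}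
    (hT : T ⊆ active p h x) (hcard : 2 < T.ncard)
    (hz : ∀ a ∈ T, ∀ b ∈ T, (inner ℝ (p a) z : ℝ) = inner ℝ (p b) z) : z = 0 := by
  obtain ⟨a, b, c, ha, hb, hc, hab, hac, hbc⟩ :=
    (two_lt_ncard_iff ((H.finite x).subset hT)).1 hcard
  exact H.eq_zero_of_inner_eq (hT ha) (hT hb) (hT hc) hab hac hbc (hz b hb a ha) (hz c hc a ha)

theorem ncard_maximizers_le (H : IsRegularEnvelope p h) {x z : Plane} (hz : z ≠ 0) :
    {a ∈ active p h x |
      ∀ c ∈ active p h x, (inner ℝ (p c) z : ℝ) ≤ inner ℝ (p a) z}.ncard ≤ 2 := by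
  by_contra! hcard
  exact hz <| H.eq_zero_of_forall_inner_eq (sep_subset _ _) hcard
    fun a ha b hb => le_antisymm (hb.2 a ha.1) (ha.2 b hb.1)

theorem isClosed_activeHull (H : IsRegularEnvelope p h) (x : Plane) :
    IsClosed (activeHull p h x) :=
  (((H.finite x).image p).isCompact_convexHull ℝ).isClosed

theorem interior_activeHull_nonempty (H : IsRegularEnvelope p h) {x : Plane}
    (hx : 2 < (active p h x).ncard) : (interior (activeHull p h x)).Nonempty := by
  refine interior_nonempty_of_inner_const (convex_activeHull x) ?_ fun z hz => ?_
  · obtain ⟨a, ha⟩ := H.nonempty x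
    exact ⟨p a, mem_activeHull ha⟩
  · exact H.eq_zero_of_forall_inner_eq Subset.rfl hx
      fun a ha b hb => hz _ (mem_activeHull ha) _ (mem_activeHull hb)

theorem closure_interior_activeHull (H : IsRegularEnvelope p h) {x : Plane}
    (hx : 2 < (active p h x).ncard) :
    closure (interior (activeHull p h x)) = activeHull p h x := by
  rw [(convex_activeHull x).closure_interior_eq_closure_of_nonempty_interior
    (H.interior_activeHull_nonempty hx), (H.isClosed_activeHull x).closure_eq]

/-- A small step from `x` along the normal of a supporting line at `y` keeps active only the
gradients on that line. There are at most two of them, and their hull contains `y`. -/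
theorem mem_hullSkeleton_of_notMem_interior (H : IsRegularEnvelope p h) {x y : Plane}
    (hy : y ∈ activeHull p h x) (hyi : y ∉ interior (activeHull p h x)) :
    y ∈ hullSkeleton p h := by
  rcases le_or_gt (active p h x).ncard 2 with hx | hx
  · exact ⟨x, hx, hy⟩
  obtain ⟨z, hz, hmax⟩ := exists_supporting (convex_activeHull x)
    (H.interior_activeHull_nonempty hx) hyi
  obtain ⟨ε, -, hε⟩ := H.exists_active_add_smul x z
  refine ⟨x + ε • z, by rw [hε]; exact H.ncard_maximizers_le hz, ?_⟩
  unfold activeHull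
  rw [hε]
  refine convexHull_mono ?_ (mem_convexHull_of_isMax (z := z) hy (by
    rintro _ ⟨a, ha, rfl⟩
    exact hmax _ (mem_activeHull ha)))
  rintro _ ⟨⟨a, ha, rfl⟩, hae⟩
  exact ⟨a, ⟨ha, fun c hc => (hmax _ (mem_activeHull hc)).trans_eq hae.symm⟩, rfl⟩

theorem exists_mem_interior_of_notMem (H : IsRegularEnvelope p h) {y : Plane}
    (hy : y ∉ hullSkeleton p h) :
    ∃ x, 2 < (active p h x).ncard ∧ y ∈ interior (activeHull p h x) := by
  obtain ⟨x, hx⟩ := H.cover y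
  refine ⟨x, not_le.1 fun hle => hy ⟨x, hle, hx⟩, ?_⟩
  by_contra hyi
  exact hy (H.mem_hullSkeleton_of_notMem_interior hx hyi)

/-- The components of the complement of the skeleton are the interiors of the hulls of more than
two active gradients. -/
theorem connectedComponentIn_compl_hullSkeleton (H : IsRegularEnvelope p h) {x y : Plane}
    (hx : 2 < (active p h x).ncard) (hy : y ∈ interior (activeHull p h x)) :
    connectedComponentIn (hullSkeleton p h)ᶜ y = interior (activeHull p h x) := by
  refine connectedComponentIn_eq_of_isOpen isOpen_interior (H.isClosed_activeHull x).isOpen_compl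
    ?_ ?_ ?_ (convex_activeHull x).interior.isPreconnected hy
  · exact disjoint_compl_right.mono_left interior_subset
  · intro w hw
    by_contra! hn
    simp only [mem_union, mem_compl_iff, not_or, not_not] at hn
    exact hw (H.mem_hullSkeleton_of_notMem_interior hn.2 hn.1)
  · exact fun w hw => notMem_hullSkeleton hx hw

/-- At a supporting line through this point, the three nonnegative slacks have a vanishing positive
combination. All three gradients would then lie on the line, against convex position. -/
theorem mem_interior_of_combo (H : IsRegularEnvelope p h) {a b c : A} {x : Plane}
    (ha : a ∈ active p h x) (hb : b ∈ active p h x) (hc : c ∈ active p h x)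
    (hab : a ≠ b) (hac : a ≠ c) (hbc : b ≠ c) {r s t : ℝ} (hr : 0 < r) (hs : 0 < s) (ht : 0 < t)
    (hsum : r + s + t = 1) : r • p a + s • p b + t • p c ∈ interior (activeHull p h x) := by
  by_contra hyi
  have hx : 2 < (active p h x).ncard :=
    (two_lt_ncard_iff (H.finite x)).2 ⟨a, b, c, ha, hb, hc, hab, hac, hbc⟩
  obtain ⟨z, hz, hmax⟩ := exists_supporting (convex_activeHull x)
    (H.interior_activeHull_nonempty hx) hyi
  have h1 := hmax _ (mem_activeHull ha)
  have h2 := hmax _ (mem_activeHull hb)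
  have h3 := hmax _ (mem_activeHull hc)
  have hval : (inner ℝ (r • p a + s • p b + t • p c) z : ℝ) =
      r * inner ℝ (p a) z + s * inner ℝ (p b) z + t * inner ℝ (p c) z := by
    simp [inner_add_left, inner_smul_left]
  set Y : ℝ := inner ℝ (r • p a + s • p b + t • p c) z with hY
  have hzero : r * (Y - inner ℝ (p a) z) + s * (Y - inner ℝ (p b) z)
      + t * (Y - inner ℝ (p c) z) = 0 := by linear_combination Y * hsum + hval
  have n1 := mul_nonneg hr.le (sub_nonneg.2 h1)
  have n2 := mul_nonneg hs.le (sub_nonneg.2 h2)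
  have n3 := mul_nonneg ht.le (sub_nonneg.2 h3)
  have e1 : Y - inner ℝ (p a) z = 0 :=
    (mul_eq_zero.1 (by linarith : r * (Y - inner ℝ (p a) z) = 0)).resolve_left hr.ne'
  have e2 : Y - inner ℝ (p b) z = 0 :=
    (mul_eq_zero.1 (by linarith : s * (Y - inner ℝ (p b) z) = 0)).resolve_left hs.ne'
  have e3 : Y - inner ℝ (p c) z = 0 :=
    (mul_eq_zero.1 (by linarith : t * (Y - inner ℝ (p c) z) = 0)).resolve_left ht.ne'
  exact hz (H.eq_zero_of_inner_eq ha hb hc hab hac hbc (by linarith) (by linarith))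

/-- If `x` is the last point, in the direction `rot (p b - p a)`, at which both `a` and `b` are
active, then some third active gradient lies to the left of the line from `p a` to `p b`. -/
theorem exists_last (H : IsRegularEnvelope p h) {a b : A} (hab : a ≠ b)
    (hne : ∃ w, a ∈ active p h w ∧ b ∈ active p h w) :
    ∃ x, a ∈ active p h x ∧ b ∈ active p h x ∧
      (∀ w, a ∈ active p h w → b ∈ active p h w →
        (inner ℝ w (rot (p b - p a)) : ℝ) ≤ inner ℝ x (rot (p b - p a))) ∧
      ∃ c ∈ active p h x, (0 : ℝ) < inner ℝ (p c - p a) (rot (p b - p a)) := by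
  set u := rot (p b - p a) with hu
  have hu0 : u ≠ 0 := rot_ne_zero (sub_ne_zero.2 fun e => hab (H.eq_of_eq e).symm)
  have huab : (inner ℝ (p b) u : ℝ) = inner ℝ (p a) u := by
    have := inner_rot_self (p b - p a)
    rw [← hu, inner_sub_left] at this
    linarith
  set C := {w | a ∈ active p h w} ∩ {w | b ∈ active p h w} with hC
  have hCc : IsCompact C := Metric.isCompact_of_isClosed_isBounded
    ((isClosed_setOf_mem_active a).inter (isClosed_setOf_mem_active b))
    ((H.bounded a).subset inter_subset_left)
  have hcont : Continuous fun w : Plane => (inner ℝ w u : ℝ) := by fun_prop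
  obtain ⟨x, hx, hmax⟩ := hCc.exists_isMaxOn hne hcont.continuousOn
  have hmax' : ∀ w ∈ C, (inner ℝ w u : ℝ) ≤ inner ℝ x u := fun w hw => hmax hw
  refine ⟨x, hx.1, hx.2, fun w ha hb => hmax' w ⟨ha, hb⟩, ?_⟩
  -- Otherwise `a` and `b` grow fastest in the direction `u`, so both stay active a little beyond
  -- `x`, against maximality.
  by_contra! hcon
  have hle : ∀ c ∈ active p h x, (inner ℝ (p c) u : ℝ) ≤ inner ℝ (p a) u := fun c hc => by
    have := hcon c hc
    rw [inner_sub_left] at this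
    linarith
  obtain ⟨ε, hε, hact⟩ := H.exists_active_add_smul x u
  have := hmax' (x + ε • u) ⟨?_, ?_⟩
  · rw [inner_add_left, inner_smul_left] at this
    have hpos : (0 : ℝ) < inner ℝ u u := real_inner_self_pos.2 hu0
    have h2 := mul_pos hε hpos
    simp only [conj_trivial] at this
    linarith
  · change a ∈ active p h (x + ε • u)
    rw [hact]
    exact ⟨hx.1, hle⟩
  · change b ∈ active p h (x + ε • u)
    rw [hact]
    exact ⟨hx.2, fun c hc => (hle c hc).trans_eq huab.symm⟩

theorem two_lt_ncard_of_inner_pos (H : IsRegularEnvelope p h) {a b c : A} {x : Plane}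
    (hab : a ≠ b) (ha : a ∈ active p h x) (hb : b ∈ active p h x) (hc : c ∈ active p h x)
    (hpos : (0 : ℝ) < inner ℝ (p c - p a) (rot (p b - p a))) : 2 < (active p h x).ncard := by
  refine (two_lt_ncard_iff (H.finite x)).2 ⟨a, b, c, ha, hb, hc, hab, ?_, ?_⟩
  · rintro rfl
    simp at hpos
  · rintro rfl
    rw [inner_rot_self] at hpos
    exact lt_irrefl _ hpos

theorem eventually_midpoint_add_mem (H : IsRegularEnvelope p h) {a b c : A} {x : Plane}
    (hab : a ≠ b) (ha : a ∈ active p h x) (hb : b ∈ active p h x) (hc : c ∈ active p h x)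
    (hpos : (0 : ℝ) < inner ℝ (p c - p a) (rot (p b - p a))) :
    ∀ᶠ ε : ℝ in 𝓝[>] 0,
      midpoint ℝ (p a) (p b) + ε • rot (p b - p a) ∈ interior (activeHull p h x) := by
  have hac : a ≠ c := by
    rintro rfl
    simp at hpos
  have hbc : b ≠ c := by
    rintro rfl
    rw [inner_rot_self] at hpos
    exact lt_irrefl _ hpos
  have hne : p b - p a ≠ 0 := sub_ne_zero.2 fun e => hab (H.eq_of_eq e).symm
  -- With `p c - p a = k (p b - p a) + d rot (p b - p a)`, the shifted midpoint is the combination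
  -- of `p a`, `p b`, `p c` with weights `1/2 + εk/d - ε/d`, `1/2 - εk/d` and `ε/d`, all positive
  -- for small `ε`.
  obtain ⟨k, hk⟩ := eq_smul_add_smul_rot hne (p c - p a)
  set d : ℝ := inner ℝ (p c - p a) (rot (p b - p a)) / inner ℝ (p b - p a) (p b - p a) with hd
  have hd0 : 0 < d := div_pos hpos (real_inner_self_pos.2 hne)
  have hs : ∀ᶠ ε : ℝ in 𝓝[>] 0, 0 < 1 / 2 - ε * (k / d) := by
    have hcont : Continuous fun ε : ℝ => 1 / 2 - ε * (k / d) := by fun_prop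
    have := (hcont.tendsto 0).mono_left (nhdsWithin_le_nhds (s := Ioi 0))
    exact this.eventually_const_lt (by norm_num)
  have hr : ∀ᶠ ε : ℝ in 𝓝[>] 0, 0 < 1 / 2 + ε * (k / d) - ε / d := by
    have hcont : Continuous fun ε : ℝ => 1 / 2 + ε * (k / d) - ε / d := by fun_prop
    have := (hcont.tendsto 0).mono_left (nhdsWithin_le_nhds (s := Ioi 0))
    exact this.eventually_const_lt (by norm_num)
  filter_upwards [hs, hr, self_mem_nhdsWithin] with ε hs hr hε
  have hε : 0 < ε := hε
  have := H.mem_interior_of_combo ha hb hc hab hac hbc hr hs (div_pos hε hd0) (by ring)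
  convert this using 1
  have hc' : p c = p a + (k • (p b - p a) + d • rot (p b - p a)) := by rw [← hk]; abel
  rw [hc', midpoint_eq_smul_add]
  have hdd : ε / d * d = ε := div_mul_cancel₀ _ hd0.ne'
  have hkd : ε * (k / d) = ε / d * k := by ring
  rw [hkd]
  nth_rewrite 1 [← hdd]
  simp only [invOf_eq_inv]
  module

theorem setOf_active_pair_eq_segment (H : IsRegularEnvelope p h) {a b : A} (hab : a ≠ b)
    {x y : Plane} (hxa : a ∈ active p h x) (hxb : b ∈ active p h x)
    (hya : a ∈ active p h y) (hyb : b ∈ active p h y)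
    (hx : ∀ w, a ∈ active p h w → b ∈ active p h w →
      (inner ℝ x (rot (p b - p a)) : ℝ) ≤ inner ℝ w (rot (p b - p a)))
    (hy : ∀ w, a ∈ active p h w → b ∈ active p h w →
      (inner ℝ w (rot (p b - p a)) : ℝ) ≤ inner ℝ y (rot (p b - p a))) :
    segment ℝ x y = {w | a ∈ active p h w} ∩ {w | b ∈ active p h w} := by
  refine Subset.antisymm (((convex_setOf_mem_active a).inter
    (convex_setOf_mem_active b)).segment_subset ⟨hxa, hxb⟩ ⟨hya, hyb⟩) ?_
  rintro w ⟨hwa, hwb⟩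
  have hne : p b - p a ≠ 0 := sub_ne_zero.2 fun e => hab (H.eq_of_eq e).symm
  have hort : ∀ w, a ∈ active p h w → b ∈ active p h w →
      ∃ c : ℝ, w - x = c • rot (p b - p a) := fun w hwa hwb => by
    refine eq_smul_rot hne ?_
    rw [real_inner_comm]
    exact inner_sub_sub_eq_zero hxa hxb hwa hwb
  obtain ⟨s, hs⟩ := hort w hwa hwb
  obtain ⟨t, ht⟩ := hort y hya hyb
  have hpos : (0 : ℝ) < inner ℝ (rot (p b - p a)) (rot (p b - p a)) :=
    real_inner_self_pos.2 (rot_ne_zero hne)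
  have hw : w = x + s • rot (p b - p a) := by rw [← hs]; abel
  have hy' : y = x + t • rot (p b - p a) := by rw [← ht]; abel
  have hval : ∀ c : ℝ, (inner ℝ (x + c • rot (p b - p a)) (rot (p b - p a)) : ℝ) =
      inner ℝ x (rot (p b - p a)) + c * inner ℝ (rot (p b - p a)) (rot (p b - p a)) := fun c => by
    rw [inner_add_left, inner_smul_left]; rfl
  have h1 := hx w hwa hwb
  have h2 := hy w hwa hwb
  rw [hw, hval] at h1
  rw [hw, hy', hval, hval] at h2
  have hs0 : 0 ≤ s := nonneg_of_mul_nonneg_left (by linarith) hpos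
  have hst : s ≤ t := le_of_mul_le_mul_right (by linarith) hpos
  rw [segment_eq_image']
  -- The case `s = 0` is separate because the segment may degenerate to a point, with `t = 0`.
  rcases hs0.eq_or_lt with rfl | hs0
  · exact ⟨0, by simp, by simp [hw]⟩
  · have ht0 : 0 < t := hs0.trans_le hst
    refine ⟨s / t, ⟨by positivity, (div_le_one ht0).2 hst⟩, ?_⟩
    change x + (s / t) • (y - x) = w
    rw [ht, hw, smul_smul, div_mul_cancel₀ _ ht0.ne']

/-- An index that is active at `x` together with others shares an edge of its cell through `x`
with one of them. -/
theorem exists_active_eq_pair (H : IsRegularEnvelope p h) {a : A} {x : Plane}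
    (ha : a ∈ active p h x) (hx : ∃ c ∈ active p h x, c ≠ a) :
    ∃ b ∈ active p h x, b ≠ a ∧ ∃ x', active p h x' = {a, b} := by
  obtain ⟨z, hz⟩ := H.exists_inner_lt a x
  -- The direction `z` is tilted toward `rot z` until a second gradient first ties with `a`. The
  -- maximizer `b` of `s` is that one: `p c - p a` pairs with `rot z + s b • z` to a positive
  -- multiple of `s c - s b`.
  set s : A → ℝ := fun c => inner ℝ (p c - p a) (rot z) / -inner ℝ (p c - p a) z with hs
  obtain ⟨b, ⟨hb, hba⟩, hmax⟩ := exists_max_image (active p h x \ {a}) s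
    ((H.finite x).subset sdiff_subset) hx
  have hba : b ≠ a := hba
  have hneg : ∀ c ∈ active p h x, c ≠ a → (inner ℝ (p c - p a) z : ℝ) < 0 := fun c hc hca => by
    rw [inner_sub_left]
    linarith [hz c hc hca]
  have hz0 : z ≠ 0 := by
    rintro rfl
    simpa using hneg b hb hba
  set v := rot z + s b • z with hv
  have hval : ∀ c, (inner ℝ (p c) v : ℝ) =
      inner ℝ (p a) v + (inner ℝ (p c - p a) (rot z) + s b * inner ℝ (p c - p a) z) := fun c => by
    simp only [hv, inner_add_right, inner_smul_right, inner_sub_left]; ring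
  have hv0 : v ≠ 0 := by
    intro h0
    have h1 : (inner ℝ (rot z) v : ℝ) = 0 := by rw [h0, inner_zero_right]
    rw [hv, inner_add_right, inner_smul_right, real_inner_comm z, inner_rot_self] at h1
    have : (0 : ℝ) < inner ℝ (rot z) (rot z) := real_inner_self_pos.2 (rot_ne_zero hz0)
    linarith
  have hle : ∀ c ∈ active p h x, (inner ℝ (p c) v : ℝ) ≤ inner ℝ (p a) v := fun c hc => by
    by_cases hca : c = a
    · rw [hca]
    · have h1 := hmax c ⟨hc, hca⟩
      have h2 := (div_le_iff₀ (neg_pos.2 (hneg c hc hca))).1 h1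
      rw [hval]
      linarith
  have hbeq : (inner ℝ (p b) v : ℝ) = inner ℝ (p a) v := by
    have h2 : s b * -inner ℝ (p b - p a) z = inner ℝ (p b - p a) (rot z) :=
      div_mul_cancel₀ _ (neg_pos.2 (hneg b hb hba)).ne'
    rw [hval]
    linarith
  obtain ⟨ε, -, hε⟩ := H.exists_active_add_smul x v
  refine ⟨b, hb, hba, x + ε • v, ?_⟩
  rw [hε]
  have hsub : ({a, b} : Set A) ⊆ {a ∈ active p h x |
      ∀ c ∈ active p h x, (inner ℝ (p c) v : ℝ) ≤ inner ℝ (p a) v} := by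
    rintro c (rfl | rfl)
    · exact ⟨ha, hle⟩
    · exact ⟨hb, fun c hc => (hle c hc).trans_eq hbeq.symm⟩
  refine (eq_of_subset_of_ncard_le hsub ?_ ((H.finite x).subset (sep_subset _ _))).symm
  rw [ncard_pair hba.symm]
  exact H.ncard_maximizers_le hv0

theorem isOpen_setOf_active_eq (H : IsRegularEnvelope p h) (a : A) :
    IsOpen {x | active p h x = {a}} := by
  refine isOpen_iff_mem_nhds.2 fun x hx => ?_
  filter_upwards [H.eventually_subset x] with y hy
  rw [show active p h x = {a} from hx] at hy
  exact (H.nonempty y).subset_singleton_iff.1 hy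

theorem isBounded_setOf_active_eq (H : IsRegularEnvelope p h) (a : A) :
    Bornology.IsBounded {x | active p h x = {a}} :=
  (H.bounded a).subset fun x hx => by
    change a ∈ active p h x
    rw [show active p h x = {a} from hx]; rfl

/-- The components of the set of points where only one function is active. -/
theorem connectedComponentIn_active_eq (H : IsRegularEnvelope p h) {X : Set Plane}
    (hX : ∀ x, x ∈ X ↔ ∃ a, active p h x = {a}) {a : A} {x : Plane} (hx : active p h x = {a}) :
    connectedComponentIn X x = {x | active p h x = {a}} := by
  refine connectedComponentIn_eq_of_isOpen (H.isOpen_setOf_active_eq a)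
    (W := ⋃ (b : A) (_ : b ≠ a), {x | active p h x = {b}})
    (isOpen_iUnion fun b => isOpen_iUnion fun _ => H.isOpen_setOf_active_eq b) ?_ ?_ ?_
    (convex_setOf_active_eq a).isPreconnected hx
  · refine disjoint_left.2 fun y hy hy' => ?_
    simp only [mem_iUnion] at hy'
    obtain ⟨b, hba, hb⟩ := hy'
    exact hba (singleton_injective ((show active p h y = {b} from hb).symm.trans hy))
  · intro y hy
    obtain ⟨b, hb⟩ := (hX y).1 hy
    by_cases hba : b = a
    · exact Or.inl (hba ▸ hb)
    · exact Or.inr (mem_iUnion₂.2 ⟨b, hba, hb⟩)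
  · exact fun y hy => (hX y).2 ⟨a, hy⟩

end IsRegularEnvelope

end Envelope

/-- A minimizer of the upper envelope minus a linear functional has the gradient of this functional
in its hull. -/
theorem mem_activeHull_of_isMin {A : Type*} {p : A → Plane} {h : A → ℝ}
    (hne : ∀ x, (active p h x).Nonempty) {x y : Plane} (hfin : (active p h x).Finite)
    (hev : ∀ᶠ w in 𝓝 x, active p h w ⊆ active p h x)
    (hmin : ∀ a ∈ active p h x, ∀ w, ∀ c ∈ active p h w,
      height p h a x - inner ℝ x y ≤ height p h c w - inner ℝ w y) :
    y ∈ activeHull p h x := by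
  by_contra hy
  -- If a line separates `y` from the hull, a small step along its normal `z` lowers the envelope
  -- minus the functional of `y`, since every active gradient grows more slowly than `y` along `z`.
  obtain ⟨f, s, hs, hsy⟩ := geometric_hahn_banach_closed_point (convex_activeHull x)
    ((hfin.image p).isCompact_convexHull ℝ).isClosed hy
  obtain ⟨z, hz⟩ := exists_inner_eq f
  have hcont : Tendsto (fun t : ℝ => x + t • z) (𝓝[>] 0) (𝓝 x) := by
    have : Continuous fun t : ℝ => x + t • z := by fun_prop
    simpa using (this.tendsto 0).mono_left nhdsWithin_le_nhds
  obtain ⟨ε, hsub, hε⟩ := ((hcont.eventually hev).and self_mem_nhdsWithin).exists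
  have hε : 0 < ε := hε
  obtain ⟨a, ha⟩ := hne (x + ε • z)
  have h1 := hmin a (hsub ha) _ a ha
  have h2 := hs _ (mem_activeHull (hsub ha))
  rw [hz] at h2 hsy
  rw [height_add, inner_smul_right, inner_add_left, inner_smul_left, real_inner_comm y z] at h1
  simp only [conj_trivial] at h1
  have h3 : ε * inner ℝ (p a) z < ε * inner ℝ y z := mul_lt_mul_of_pos_left (h2.trans hsy) hε
  linarith

/-! ### The period lattice -/

section Lattice

variable (M : Matrix (Fin 2) (Fin 2) ℝ)

theorem period_zero : period M 0 = 0 := by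
  ext i
  fin_cases i <;> simp [period]

theorem period_add (k l : Z2) : period M (k + l) = period M k + period M l := by
  ext i
  fin_cases i <;> simp [period] <;> ring

variable {M}

/-- Every point of the plane is within a bounded distance of the lattice. -/
theorem exists_norm_sub_period_le (hM : M.det ≠ 0) :
    ∃ R : ℝ, ∀ x : Plane, ∃ k : Z2, ‖x - period M k‖ ≤ R := by
  have hcont : Continuous fun t : Fin 2 → ℝ => (WithLp.toLp 2 (M *ᵥ t) : Plane) := by fun_prop
  obtain ⟨R, hR⟩ := ((isCompact_univ_pi fun _ : Fin 2 => isCompact_Icc (a := (0 : ℝ))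
    (b := 1)).image hcont).isBounded.exists_norm_le
  -- Rounding the lattice coordinates down leaves a remainder in the image of the unit square, whose
  -- norm `R` bounds.
  refine ⟨R, fun x => ⟨fun i => ⌊(M⁻¹ *ᵥ WithLp.ofLp x) i⌋, ?_⟩⟩
  refine (congrArg norm ?_).trans_le (hR _ ⟨fun i => Int.fract ((M⁻¹ *ᵥ WithLp.ofLp x) i),
    fun i _ => ⟨Int.fract_nonneg _, (Int.fract_lt_one _).le⟩, rfl⟩)
  have : (fun i => Int.fract ((M⁻¹ *ᵥ WithLp.ofLp x) i)) =
      M⁻¹ *ᵥ WithLp.ofLp x - fun i => (⌊(M⁻¹ *ᵥ WithLp.ofLp x) i⌋ : ℝ) := rfl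
  beta_reduce
  rw [this, Matrix.mulVec_sub, Matrix.mulVec_mulVec,
    Matrix.mul_nonsing_inv _ (isUnit_iff_ne_zero.2 hM), Matrix.one_mulVec]
  rfl

/-- Every bounded region contains finitely many lattice vectors. -/
theorem finite_setOf_norm_period_le (hM : M.det ≠ 0) (R : ℝ) :
    {k : Z2 | ‖period M k‖ ≤ R}.Finite := by
  have hcont : Continuous fun x : Plane => M⁻¹ *ᵥ WithLp.ofLp x := by fun_prop
  obtain ⟨C, hC⟩ := ((isCompact_closedBall (0 : Plane) R).image hcont).isBounded.exists_norm_le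
  refine (finite_Icc (fun _ : Fin 2 => -⌈C⌉) fun _ => ⌈C⌉).subset fun k hk => ?_
  have h1 : ‖fun i => (k i : ℝ)‖ ≤ C := by
    refine (congrArg norm ?_).trans_le (hC _ ⟨period M k, by simpa using hk, rfl⟩)
    change _ = M⁻¹ *ᵥ (M *ᵥ fun i => (k i : ℝ))
    rw [Matrix.mulVec_mulVec, Matrix.nonsing_inv_mul _ (isUnit_iff_ne_zero.2 hM),
      Matrix.one_mulVec]
  have h2 : ∀ i, |k i| ≤ ⌈C⌉ := fun i => by
    have h3 : |(k i : ℝ)| ≤ C := (norm_le_pi_norm (fun i => (k i : ℝ)) i).trans h1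
    exact_mod_cast h3.trans (Int.le_ceil C)
  exact ⟨fun i => (abs_le.1 (h2 i)).1, fun i => (abs_le.1 (h2 i)).2⟩

end Lattice

/-! ### Power diagrams of periodic point sets -/

namespace GeodesicDrawing

variable {M : Matrix (Fin 2) (Fin 2) ℝ} {V D : Type*} (G : GeodesicDrawing M V D) (π : V → ℝ)

/-- The constant terms of the affine functions whose upper envelope is dual to the power
diagram. -/
noncomputable def lift (a : V × Z2) : ℝ := ‖G.cover.pos a‖ ^ 2 / 2 - π a.1

/-- The term `‖x‖ ^ 2 / 2` is common to all vertices, so least power distance means greatest affine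
function. -/
theorem power_eq (a : V × Z2) (x : Plane) :
    G.power π a x = ‖x‖ ^ 2 / 2 - height G.cover.pos (G.lift π) a x := by
  rw [power, height, lift, norm_sub_sq_real, real_inner_comm x]
  ring

theorem mem_cell_iff {a : V × Z2} {x : Plane} :
    x ∈ G.cell π a ↔ a ∈ active G.cover.pos (G.lift π) x := by
  simp only [cell, active, mem_ofPred_eq, power_eq, sub_le_sub_iff_left]

theorem cover_pos_add (v : V) (j k : Z2) :
    G.cover.pos (v, j + k) = G.cover.pos (v, j) + period M k := by
  simp only [cover, period_add]
  abel

theorem power_add_period (v : V) (j k : Z2) (x : Plane) :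
    G.power π (v, j + k) (x + period M k) = G.power π (v, j) x := by
  simp only [power, cover_pos_add, add_sub_add_right_eq_sub]

theorem mem_cell_add_period {v : V} {j k : Z2} {x : Plane} :
    x + period M k ∈ G.cell π (v, j + k) ↔ x ∈ G.cell π (v, j) := by
  constructor
  · rintro h ⟨w, l⟩
    have := h (w, l + k)
    rwa [power_add_period, power_add_period] at this
  · rintro h ⟨w, l⟩
    have := h (w, l - k)
    rw [← power_add_period G π w (l - k) k, sub_add_cancel] at this
    rwa [power_add_period]

variable {G π}

theorem finite_setOf_norm_sub_pos_le [Finite V] (hM : M.det ≠ 0) (x : Plane) (R : ℝ) :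
    {a : V × Z2 | ‖x - G.cover.pos a‖ ≤ R}.Finite := by
  refine (finite_iUnion fun v : V => (finite_setOf_norm_period_le hM
    (R + ‖x - G.coord v‖)).image fun k => (v, k)).subset ?_
  rintro ⟨v, k⟩ hk
  refine mem_iUnion.2 ⟨v, k, ?_, rfl⟩
  have h1 : ‖x - (G.coord v + period M k)‖ ≤ R := hk
  have h2 : period M k = (x - G.coord v) - (x - (G.coord v + period M k)) := by abel
  change ‖period M k‖ ≤ _
  rw [h2]
  linarith [norm_sub_le (x - G.coord v) (x - (G.coord v + period M k))]

variable (G π) in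
/-- The power distances are bounded below, and the least one is bounded above. -/
theorem exists_power_bounds [Finite V] [Nonempty V] (hM : M.det ≠ 0) :
    ∃ B C : ℝ, (∀ a x, ‖x - G.cover.pos a‖ ^ 2 / 2 - B ≤ G.power π a x) ∧
      ∀ x, ∃ a, G.power π a x ≤ C := by
  obtain ⟨B, hB⟩ := (finite_range π).bddAbove
  obtain ⟨R, hR⟩ := exists_norm_sub_period_le hM
  obtain ⟨v⟩ := ‹Nonempty V›
  refine ⟨B, R ^ 2 / 2 - π v, fun a x => ?_, fun x => ?_⟩
  · have := hB (mem_range_self a.1)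
    unfold power
    linarith
  · obtain ⟨k, hk⟩ := hR (x - G.coord v)
    refine ⟨(v, k), ?_⟩
    have h1 : x - G.cover.pos (v, k) = x - G.coord v - period M k := by
      simp only [cover]; abel
    unfold power
    rw [h1]
    have := pow_le_pow_left₀ (norm_nonneg _) hk 2
    linarith

variable (G π) in
theorem exists_norm_sub_pos_le [Finite V] [Nonempty V] (hM : M.det ≠ 0) :
    ∃ R : ℝ, ∀ x, ∀ a ∈ active G.cover.pos (G.lift π) x, ‖x - G.cover.pos a‖ ≤ R := by
  obtain ⟨B, C, hB, hC⟩ := exists_power_bounds G π hM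
  refine ⟨√(2 * (C + B)), fun x a ha => ?_⟩
  obtain ⟨c, hc⟩ := hC x
  refine Real.le_sqrt_of_sq_le ?_
  have := (G.mem_cell_iff π).2 ha c
  linarith [hB a x]

variable (G π) in
theorem active_nonempty [Finite V] [Nonempty V] (hM : M.det ≠ 0) (x : Plane) :
    (active G.cover.pos (G.lift π) x).Nonempty := by
  obtain ⟨B, C, hB, hC⟩ := exists_power_bounds G π hM
  have hfin : {a | G.power π a x ≤ C}.Finite := by
    refine (finite_setOf_norm_sub_pos_le (G := G) hM x √(2 * (C + B))).subset fun a ha => ?_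
    refine Real.le_sqrt_of_sq_le ?_
    have ha : G.power π a x ≤ C := ha
    linarith [hB a x]
  obtain ⟨a, ha, hmin⟩ := exists_min_image _ (fun a => G.power π a x) hfin (hC x)
  refine ⟨a, (G.mem_cell_iff π).1 fun c => ?_⟩
  rcases le_or_gt (G.power π c x) C with h | h
  · exact hmin c h
  · exact (show G.power π a x ≤ C from ha).trans h.le

variable (G π) in
-- Only the finitely many vertices within `R + 1` of `x` can be active at points within distance `1`
-- of `x`. Those inactive at `x` are strictly below `b` there, hence also nearby.
theorem eventually_active_subset [Finite V] [Nonempty V] (hM : M.det ≠ 0) (x : Plane) :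
    ∀ᶠ y in 𝓝 x, active G.cover.pos (G.lift π) y ⊆ active G.cover.pos (G.lift π) x := by
  obtain ⟨R, hR⟩ := exists_norm_sub_pos_le G π hM
  obtain ⟨b, hb⟩ := active_nonempty G π hM x
  have hev : ∀ᶠ y in 𝓝 x, ∀ a ∈ {a : V × Z2 | ‖x - G.cover.pos a‖ ≤ R + 1},
      a ∉ active G.cover.pos (G.lift π) x →
        height G.cover.pos (G.lift π) a y < height G.cover.pos (G.lift π) b y := by
    refine (eventually_all_finite (finite_setOf_norm_sub_pos_le hM x (R + 1))).2 fun a _ => ?_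
    by_cases ha : a ∈ active G.cover.pos (G.lift π) x
    · exact Eventually.of_forall fun y h => absurd ha h
    · filter_upwards [(continuous_height a).continuousAt.eventually_lt
        (continuous_height b).continuousAt (height_lt_of_notMem_active hb ha)] with y hy _ using hy
  filter_upwards [hev, Metric.ball_mem_nhds x one_pos] with y hy hyx a ha
  by_contra hn
  refine (ha b).not_gt (hy a ?_ hn)
  have h1 := hR y a ha
  have h2 : ‖x - y‖ < 1 := by rwa [mem_ball_iff_norm, norm_sub_rev] at hyx
  change ‖x - G.cover.pos a‖ ≤ R + 1
  linarith [norm_sub_le_norm_sub_add_norm_sub x y (G.cover.pos a)]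

variable (G π) in
theorem active_finite [Finite V] [Nonempty V] (hM : M.det ≠ 0) (x : Plane) :
    (active G.cover.pos (G.lift π) x).Finite := by
  obtain ⟨R, hR⟩ := exists_norm_sub_pos_le G π hM
  exact (finite_setOf_norm_sub_pos_le hM x R).subset fun a ha => hR x a ha

variable (G π) in
-- The envelope minus the functional of `y` is lower semicontinuous, as a supremum of affine
-- functions. It equals `‖x - y‖² / 2` minus a quantity bounded above, up to a constant, so a
-- minimizer exists, and `y` is a subgradient there.
theorem exists_mem_activeHull [Finite V] [Nonempty V] (hM : M.det ≠ 0) (y : Plane) :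
    ∃ x, y ∈ activeHull G.cover.pos (G.lift π) x := by
  obtain ⟨B, C, hB, hC⟩ := exists_power_bounds G π hM
  choose n hn using active_nonempty G π hM
  set f : Plane → ℝ := fun x => height G.cover.pos (G.lift π) (n x) x - inner ℝ x y with hf
  have hlsc : LowerSemicontinuous f := by
    intro x s hs
    have hcont : Continuous fun w => height G.cover.pos (G.lift π) (n x) w - inner ℝ w y :=
      (continuous_height _).sub (by fun_prop)
    filter_upwards [hcont.continuousAt.eventually_const_lt hs] with w hw
    exact hw.trans_le (sub_le_sub_right (hn w (n x)) _)
  have hval : ∀ x, f x = ‖x - y‖ ^ 2 / 2 - ‖y‖ ^ 2 / 2 - G.power π (n x) x := fun x => by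
    simp only [hf]
    rw [power_eq, norm_sub_sq_real]
    ring
  obtain ⟨x, -, hx⟩ := (hlsc.lowerSemicontinuousOn _).exists_isMinOn
    -- Outside this ball `f` exceeds `B - ‖y‖² / 2`, which is at least `f y`.
    (s := Metric.closedBall y √(2 * (C + B))) ⟨y, Metric.mem_closedBall_self (Real.sqrt_nonneg _)⟩
    (isCompact_closedBall y _)
  have hmin : ∀ w, f x ≤ f w := fun w => by
    by_cases hw : w ∈ Metric.closedBall y √(2 * (C + B))
    · exact hx hw
    · refine (hx (Metric.mem_closedBall_self (Real.sqrt_nonneg _))).trans ?_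
      rw [mem_closedBall_iff_norm, not_le] at hw
      have h1 := (Real.sqrt_lt' ((Real.sqrt_nonneg _).trans_lt hw)).1 hw
      obtain ⟨c, hc⟩ := hC w
      have h2 := (G.mem_cell_iff π).2 (hn w) c
      have h3 := hB (n y) y
      change f y ≤ f w
      rw [hval, hval, sub_self, norm_zero]
      have h4 := sq_nonneg ‖y - G.cover.pos (n y)‖
      linarith
  refine ⟨x, mem_activeHull_of_isMin (active_nonempty G π hM) (active_finite G π hM x)
    (eventually_active_subset G π hM x) fun a ha w c hc => ?_⟩
  rw [height_eq_of_active ha (hn x), height_eq_of_active hc (hn w)]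
  exact hmin w

theorem IsWeightedDelaunay.isRegularEnvelope [Finite V] [Nonempty V] (hM : M.det ≠ 0)
    (hπ : G.IsWeightedDelaunay π) : IsRegularEnvelope G.cover.pos (G.lift π) where
  nonempty := active_nonempty G π hM
  finite := active_finite G π hM
  eventually_subset := eventually_active_subset G π hM
  bounded a := by
    obtain ⟨R, hR⟩ := exists_norm_sub_pos_le G π hM
    refine (Metric.isBounded_closedBall (x := G.cover.pos a) (r := R)).subset fun x hx => ?_
    rw [mem_closedBall_iff_norm]
    exact hR x a hx
  cover := exists_mem_activeHull G π hM
  vertex a := by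
    obtain ⟨x, hx⟩ := hπ.vertex a
    refine ⟨x, Subset.antisymm (fun c hc => ?_) (singleton_subset_iff.2 ?_)⟩
    · by_contra hca
      exact ((G.mem_cell_iff π).2 hc a).not_gt (hx c hca)
    · refine (G.mem_cell_iff π).1 fun c => ?_
      by_cases hca : c = a
      · rw [hca]
      · exact (hx c hca).le

/-- Two lifted vertices are adjacent in a weighted Delaunay graph if and only if they are the only
nearest ones of some point. -/
theorem IsWeightedDelaunay.exists_edge_iff (hπ : G.IsWeightedDelaunay π) {a b : V × Z2}
    (hab : a ≠ b) : (∃ e, G.cover.tail e = a ∧ G.cover.head e = b) ↔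
      ∃ x, active G.cover.pos (G.lift π) x = {a, b} := by
  rw [hπ.edge a b hab]
  refine exists_congr fun x => ⟨fun ⟨he, hlt⟩ => ?_, fun hx => ?_⟩
  · have ha : x ∈ G.cell π a := fun c => by
      by_cases hca : c = a
      · rw [hca]
      by_cases hcb : c = b
      · rw [hcb, he]
      exact (hlt c hca hcb).le
    refine Subset.antisymm (fun c hc => ?_) ?_
    · by_contra hn
      simp only [mem_insert_iff, mem_singleton_iff, not_or] at hn
      exact ((G.mem_cell_iff π).2 hc a).not_gt (hlt c hn.1 hn.2)
    · rintro c (rfl | rfl)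
      · exact (G.mem_cell_iff π).1 ha
      · refine (G.mem_cell_iff π).1 fun d => ?_
        rw [← he]
        exact ha d
  · have ha : a ∈ active G.cover.pos (G.lift π) x := by rw [hx]; simp
    have hb : b ∈ active G.cover.pos (G.lift π) x := by rw [hx]; simp
    refine ⟨le_antisymm ((G.mem_cell_iff π).2 ha b) ((G.mem_cell_iff π).2 hb a),
      fun c hca hcb => ?_⟩
    rw [power_eq, power_eq, sub_lt_sub_iff_left]
    refine height_lt_of_notMem_active ha ?_
    rw [hx]
    simp [hca, hcb]

end GeodesicDrawing

/-- Equal active sets have equal hulls, and the interior of this hull is nonempty. -/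
theorem IsRegularEnvelope.eq_of_active_eq {A : Type*} {p : A → Plane} {h : A → ℝ}
    (H : IsRegularEnvelope p h) {x x' : Plane} (hx : 2 < (active p h x).ncard)
    (he : active p h x' = active p h x) : x' = x := by
  obtain ⟨y, hy⟩ := H.interior_activeHull_nonempty hx
  refine eq_of_mem_interior_activeHull hy ?_
  unfold activeHull
  rw [he]
  exact interior_subset hy

namespace GeodesicDrawing

variable {M : Matrix (Fin 2) (Fin 2) ℝ} {V D : Type*} {G : GeodesicDrawing M V D} {π : V → ℝ}

/-! ### Torus graphs -/

variable (G) in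
theorem cover_rev_rev (b : D × Z2) : G.cover.rev (G.cover.rev b) = b := by
  simp [cover, G.rev_rev, G.hom_rev]

variable (G) in
theorem cover_head_rev (b : D × Z2) : G.cover.head (G.cover.rev b) = G.cover.tail b := by
  rw [LineDrawing.head, cover_rev_rev]

/-- With no vertices the whole plane would be a face, and every translation preserves it. -/
theorem IsTorusGraph.nonempty (hG : G.IsTorusGraph) : Nonempty V := by
  by_contra hV
  have hs : G.cover.support = ∅ := by
    have h1 : IsEmpty V := not_nonempty_iff.1 hV
    have h2 : IsEmpty D := ⟨fun d => h1.false (G.tail d)⟩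
    simp [LineDrawing.support, range_eq_empty]
  have hF : G.cover.IsFace univ := by
    refine ⟨0, by simp [hs], ?_⟩
    rw [hs, compl_empty, connectedComponentIn_univ]
    exact (PreconnectedSpace.connectedComponent_eq_univ 0).symm
  have := (hG.2 univ hF).2 1 (image_univ_of_surjective (add_right_surjective _))
  simpa using congrFun this 0

/-- The open segment from a point to itself is that point, so a degenerate edge would contain a
vertex. -/
theorem IsTorusGraph.tail_ne_head (hG : G.IsTorusGraph) (b : D × Z2) :
    G.cover.tail b ≠ G.cover.head b := by
  intro h
  refine hG.1.vertex_notMem (G.cover.tail b) b ?_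
  rw [LineDrawing.openEdge, ← h, openSegment_same]
  rfl

/-- The universal cover of a torus graph has no parallel edges. -/
theorem IsTorusGraph.eq_or_eq_rev (hG : G.IsTorusGraph) {b b' : D × Z2}
    (h : ({G.cover.tail b, G.cover.head b} : Set (V × Z2)) =
      {G.cover.tail b', G.cover.head b'}) : b' = b ∨ b' = G.cover.rev b := by
  refine hG.1.edge_disjoint b b' ?_
  have he : G.cover.openEdge b' = G.cover.openEdge b := by
    unfold LineDrawing.openEdge
    rcases pair_eq_pair_iff.1 h with ⟨h1, h2⟩ | ⟨h1, h2⟩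
    · rw [h1, h2]
    · rw [h1, h2, openSegment_symm]
  rw [he, inter_self]
  exact ⟨_, midpoint_mem_openSegment _ _⟩

/-! ### Faces of weighted Delaunay graphs -/

namespace IsWeightedDelaunay

theorem exists_active_eq (hπ : G.IsWeightedDelaunay π) (hG : G.IsTorusGraph) (b : D × Z2) :
    ∃ x, active G.cover.pos (G.lift π) x = {G.cover.tail b, G.cover.head b} :=
  (hπ.exists_edge_iff (hG.tail_ne_head b)).1 ⟨b, rfl, rfl⟩

/-- A hull of one gradient is a vertex. A hull of two is an edge by the Delaunay condition, and
every vertex and edge arises in this way. -/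
theorem support_eq (hπ : G.IsWeightedDelaunay π) (hG : G.IsTorusGraph)
    (H : IsRegularEnvelope G.cover.pos (G.lift π)) :
    G.cover.support = hullSkeleton G.cover.pos (G.lift π) := by
  ext y
  constructor
  · rintro (⟨a, rfl⟩ | hy)
    · obtain ⟨x, hx⟩ := H.vertex a
      exact ⟨x, by simp [hx], mem_activeHull (by rw [hx]; rfl)⟩
    · obtain ⟨b, hb⟩ := mem_iUnion.1 hy
      obtain ⟨x, hx⟩ := hπ.exists_active_eq hG b
      refine ⟨x, by rw [hx, ncard_pair (hG.tail_ne_head b)], ?_⟩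
      rw [activeHull, hx, image_pair, convexHull_pair]
      exact hb
  · rintro ⟨x, hcard, hy⟩
    obtain ⟨a, ha⟩ := H.nonempty x
    by_cases hx : ∃ c ∈ active G.cover.pos (G.lift π) x, c ≠ a
    · obtain ⟨c, hc, hca⟩ := hx
      have hpair : active G.cover.pos (G.lift π) x = {a, c} := by
        refine (eq_of_subset_of_ncard_le ?_ ?_ (H.finite x)).symm
        · rintro _ (rfl | rfl) <;> assumption
        · rwa [ncard_pair hca.symm]
      obtain ⟨b, hb, hb'⟩ := (hπ.exists_edge_iff hca.symm).2 ⟨x, hpair⟩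
      rw [activeHull, hpair, image_pair, convexHull_pair] at hy
      refine Or.inr (mem_iUnion.2 ⟨b, ?_⟩)
      rwa [LineDrawing.edge, hb, hb']
    · push Not at hx
      have hone : active G.cover.pos (G.lift π) x = {a} :=
        Subset.antisymm hx (singleton_subset_iff.2 ha)
      rw [activeHull, hone, image_singleton, convexHull_singleton] at hy
      exact Or.inl ⟨a, hy.symm⟩

/-- The faces of a weighted Delaunay graph are the interiors of the convex hulls of the vertices
nearest to the points with more than two nearest vertices. -/
theorem isFace_iff (hπ : G.IsWeightedDelaunay π) (hG : G.IsTorusGraph)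
    (H : IsRegularEnvelope G.cover.pos (G.lift π)) {F : Set Plane} :
    G.cover.IsFace F ↔ ∃ x, 2 < (active G.cover.pos (G.lift π) x).ncard ∧
      F = interior (activeHull G.cover.pos (G.lift π) x) := by
  rw [LineDrawing.IsFace, hπ.support_eq hG H]
  constructor
  · rintro ⟨y, hy, rfl⟩
    obtain ⟨x, hx, hyx⟩ := H.exists_mem_interior_of_notMem hy
    exact ⟨x, hx, H.connectedComponentIn_compl_hullSkeleton hx hyx⟩
  · rintro ⟨x, hx, rfl⟩
    obtain ⟨y, hy⟩ := H.interior_activeHull_nonempty hx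
    exact ⟨y, notMem_hullSkeleton hx hy,
      (H.connectedComponentIn_compl_hullSkeleton hx hy).symm⟩

/-- The left face of a dart, and the dual point of this face. -/
theorem exists_isLeftFace (hπ : G.IsWeightedDelaunay π) (hG : G.IsTorusGraph)
    (H : IsRegularEnvelope G.cover.pos (G.lift π)) (b : D × Z2) :
    ∃ x, 2 < (active G.cover.pos (G.lift π) x).ncard ∧
      G.cover.IsLeftFace (interior (activeHull G.cover.pos (G.lift π) x)) b ∧
      G.cover.tail b ∈ active G.cover.pos (G.lift π) x ∧
      G.cover.head b ∈ active G.cover.pos (G.lift π) x ∧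
      ∀ w, G.cover.tail b ∈ active G.cover.pos (G.lift π) w →
        G.cover.head b ∈ active G.cover.pos (G.lift π) w →
        (inner ℝ w (rot (G.cover.disp b)) : ℝ) ≤ inner ℝ x (rot (G.cover.disp b)) := by
  have hne := hG.tail_ne_head b
  obtain ⟨x₀, hx₀⟩ := hπ.exists_active_eq hG b
  obtain ⟨x, ha, hb, hmax, c, hc, hpos⟩ := H.exists_last hne ⟨x₀, by simp [hx₀], by simp [hx₀]⟩
  exact ⟨x, H.two_lt_ncard_of_inner_pos hne ha hb hc hpos,
    H.eventually_midpoint_add_mem hne ha hb hc hpos, ha, hb, hmax⟩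

end IsWeightedDelaunay

theorem eq_of_isLeftFace {x x' : Plane} {b : D × Z2}
    (h : G.cover.IsLeftFace (interior (activeHull G.cover.pos (G.lift π) x)) b)
    (h' : G.cover.IsLeftFace (interior (activeHull G.cover.pos (G.lift π) x')) b) : x' = x := by
  obtain ⟨ε, h1, h2⟩ := (h.and h').exists
  exact eq_of_mem_interior_activeHull h1 (interior_subset h2)

theorem eq_of_active_iff_mem_closure {F : Set Plane} {x y : Plane}
    (H : IsRegularEnvelope G.cover.pos (G.lift π))
    (hx : 2 < (active G.cover.pos (G.lift π) x).ncard)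
    (hF : F = interior (activeHull G.cover.pos (G.lift π) x))
    (hy : ∀ a, a ∈ active G.cover.pos (G.lift π) y ↔ G.cover.pos a ∈ closure F) : y = x := by
  refine H.eq_of_active_eq hx (ext fun a => ?_)
  rw [hy, hF, H.closure_interior_activeHull hx, H.mem_activeHull_iff]

/-! ### The weighted Voronoi diagram -/

namespace DualDrawing

variable {S : G.DualDrawing}

variable (S π) in
/-- Every face is the interior of the convex hull of the vertices that are nearest to its dual
point. -/
def IsHullDual : Prop := ∀ F, 2 < (active G.cover.pos (G.lift π) (S.pos F)).ncard ∧
  F.1 = interior (activeHull G.cover.pos (G.lift π) (S.pos F))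

theorem IsWeightedVoronoi.isHullDual (hS : S.IsWeightedVoronoi π) (hπ : G.IsWeightedDelaunay π)
    (hG : G.IsTorusGraph) (H : IsRegularEnvelope G.cover.pos (G.lift π)) : S.IsHullDual π := by
  intro F
  obtain ⟨x, hx, hF⟩ := (hπ.isFace_iff hG H).1 F.2
  have : S.pos F = x := eq_of_active_iff_mem_closure H hx hF fun a => by
    rw [← mem_cell_iff, hS.vertex]
  rw [this]
  exact ⟨hx, hF⟩

variable (G π) in
theorem exists_isHullDual (hπ : G.IsWeightedDelaunay π) (hG : G.IsTorusGraph)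
    (H : IsRegularEnvelope G.cover.pos (G.lift π)) : ∃ S : G.DualDrawing, S.IsHullDual π := by
  choose pos hpos hF using fun F : G.cover.Face => (hπ.isFace_iff hG H).1 F.2
  choose x hx hleft _ using hπ.exists_isLeftFace hG H
  refine ⟨⟨pos, fun b => ⟨_, (hπ.isFace_iff hG H).2 ⟨x b, hx b, rfl⟩⟩, hleft, ?_⟩,
    fun F => ⟨hpos F, hF F⟩⟩
  intro F F' k hFF'
  -- The translate of the point of `F` has as active indices the vertices in the closure of `F'`,
  -- and these determine the point of `F'`.
  refine (eq_of_active_iff_mem_closure H (hpos F') (hF F') fun a => ?_).symm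
  obtain ⟨v, j⟩ := a
  have hcl : closure F'.1 = (fun x => x + period M k) '' closure F.1 := by
    rw [hFF']
    exact ((Homeomorph.addRight (period M k)).image_closure F.1).symm
  have hj : j = j - k + k := by abel
  rw [hcl, ← mem_cell_iff, hj, mem_cell_add_period, cover_pos_add, mem_cell_iff,
    (add_left_injective (period M k)).mem_set_image, hF F, H.closure_interior_activeHull (hpos F),
    H.mem_activeHull_iff]

theorem IsHullDual.edge_eq (hS : S.IsHullDual π) (hπ : G.IsWeightedDelaunay π)
    (hG : G.IsTorusGraph) (H : IsRegularEnvelope G.cover.pos (G.lift π)) (b : D × Z2) :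
    S.cover.edge b = G.cell π (G.cover.tail b) ∩ G.cell π (G.cover.head b) := by
  -- The point of the left face is the last point of the common cell boundary in the direction `rot
  -- (disp b)`. Applied to the reversed dart, this makes the point of the right face the first.
  have key : ∀ b, G.cover.tail b ∈ active G.cover.pos (G.lift π) (S.pos (S.left b)) ∧
      G.cover.head b ∈ active G.cover.pos (G.lift π) (S.pos (S.left b)) ∧
      ∀ w, G.cover.tail b ∈ active G.cover.pos (G.lift π) w →
        G.cover.head b ∈ active G.cover.pos (G.lift π) w →
        (inner ℝ w (rot (G.cover.disp b)) : ℝ) ≤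
          inner ℝ (S.pos (S.left b)) (rot (G.cover.disp b)) := fun b => by
    obtain ⟨x, hx, hleft, h⟩ := hπ.exists_isLeftFace hG H b
    have h' := S.isLeftFace_left b
    rw [(hS (S.left b)).2] at h'
    rwa [eq_of_isLeftFace hleft h']
  obtain ⟨ha, hb, hmax⟩ := key b
  obtain ⟨hb', ha', hmin⟩ := key (G.cover.rev b)
  rw [cover_head_rev] at ha' hmin
  have hdisp : G.cover.disp (G.cover.rev b) = -G.cover.disp b := by
    rw [LineDrawing.disp, LineDrawing.disp, cover_head_rev, neg_sub]
    rfl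
  rw [hdisp, rot_neg] at hmin
  have hseg := H.setOf_active_pair_eq_segment (hG.tail_ne_head b) ha' hb' ha hb
    (fun w hwa hwb => by
      have := hmin w hwb hwa
      rwa [inner_neg_right, inner_neg_right, neg_le_neg_iff] at this) hmax
  have hcell : ∀ a, G.cell π a = {w | a ∈ active G.cover.pos (G.lift π) w} :=
    fun a => ext fun w => G.mem_cell_iff π
  rw [hcell, hcell, ← hseg]
  change segment ℝ (S.pos (S.left (G.cover.rev b)))
    (S.pos (S.left (G.cover.rev (G.cover.rev b)))) = _
  rw [cover_rev_rev]

theorem IsHullDual.isWeightedVoronoi (hS : S.IsHullDual π) (hπ : G.IsWeightedDelaunay π)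
    (hG : G.IsTorusGraph) (H : IsRegularEnvelope G.cover.pos (G.lift π)) :
    S.IsWeightedVoronoi π where
  vertex F a := by
    rw [mem_cell_iff, (hS F).2, H.closure_interior_activeHull (hS F).1, H.mem_activeHull_iff]
  edge := hS.edge_eq hπ hG H
  skeleton := by
    ext x
    simp only [mem_iUnion, hS.edge_eq hπ hG H]
    constructor
    · rintro ⟨b, hb⟩
      exact ⟨_, _, hG.tail_ne_head b, hb⟩
    · rintro ⟨a, c, hac, ha, hc⟩
      rw [mem_cell_iff] at ha hc
      -- The given `a` and `c` may be nonadjacent, for instance opposite corners of a face; `b` is a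
      -- neighbor of `a` whose cell also contains `x`.
      obtain ⟨b, hb, hba, hx'⟩ := H.exists_active_eq_pair ha ⟨c, hc, hac.symm⟩
      obtain ⟨e, he, he'⟩ := (hπ.exists_edge_iff hba.symm).2 hx'
      refine ⟨e, ?_⟩
      rw [he, he']
      exact ⟨(G.mem_cell_iff π).2 ha, (G.mem_cell_iff π).2 hb⟩

theorem IsHullDual.eq {S' : G.DualDrawing} (hS : S.IsHullDual π) (hS' : S'.IsHullDual π) :
    S' = S := by
  refine DualDrawing.ext (funext fun F => ?_) (funext fun b => Subtype.ext ?_)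
  · obtain ⟨y, hy, hF⟩ := F.2
    have h1 : y ∈ F.1 := by
      rw [hF]
      exact mem_connectedComponentIn hy
    have h2 := h1
    rw [(hS F).2] at h1
    rw [(hS' F).2] at h2
    exact eq_of_mem_interior_activeHull h1 (interior_subset h2)
  · have h1 := S.isLeftFace_left b
    have h2 := S'.isLeftFace_left b
    rw [(hS _).2] at h1
    rw [(hS' _).2] at h2
    rw [(hS (S.left b)).2, (hS' (S'.left b)).2, eq_of_isLeftFace h1 h2]

/-! ### Orthogonality, embedding and cellularity of the Voronoi drawing. -/

namespace IsWeightedVoronoi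

theorem isOrthogonal (hS : S.IsWeightedVoronoi π) : S.IsOrthogonal := by
  intro b
  have h1 : S.cover.pos (S.cover.tail b) ∈ S.cover.edge b := left_mem_segment ℝ _ _
  have h2 : S.cover.pos (S.cover.head b) ∈ S.cover.edge b := right_mem_segment ℝ _ _
  rw [hS.edge b] at h1 h2
  simp only [mem_inter_iff, mem_cell_iff] at h1 h2
  exact inner_sub_sub_eq_zero h1.1 h1.2 h2.1 h2.2

/-- A third index active inside the dual edge would be active at both ends, hence on the whole edge;
but the edge contains a point where only the two endpoints of `b` are active. -/
theorem active_eq_of_mem_openEdge (hS : S.IsWeightedVoronoi π) (hπ : G.IsWeightedDelaunay π)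
    (hG : G.IsTorusGraph) {b : D × Z2} {x : Plane} (hx : x ∈ S.cover.openEdge b) :
    active G.cover.pos (G.lift π) x = {G.cover.tail b, G.cover.head b} := by
  have hedge := hS.edge b
  have h0 := openSegment_subset_segment ℝ _ _ hx
  have h1 : S.cover.pos (S.cover.tail b) ∈ S.cover.edge b := left_mem_segment ℝ _ _
  have h2 : S.cover.pos (S.cover.head b) ∈ S.cover.edge b := right_mem_segment ℝ _ _
  obtain ⟨x₀, hx₀⟩ := hπ.exists_active_eq hG b
  have h3 : x₀ ∈ S.cover.edge b := by
    rw [hedge]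
    simp [mem_cell_iff, hx₀]
  change x ∈ S.cover.edge b at h0
  rw [hedge] at h0 h1 h2
  simp only [mem_inter_iff, mem_cell_iff] at h0 h1 h2
  refine Subset.antisymm (fun c hc => ?_) ?_
  · obtain ⟨hc1, hc2⟩ := mem_active_of_mem_openSegment h1.1 h2.1 hx hc
    have := (convex_setOf_mem_active c).segment_subset hc1 hc2 h3
    rw [← hx₀]
    exact this
  · rintro c (rfl | rfl)
    exacts [h0.1, h0.2]

/-- Active sets tell the pieces apart: more than two indices at a dual vertex, and exactly the
endpoints of `b` inside the dual of `b`, where the pair determines the edge. -/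
theorem isEmbedding (hS : S.IsWeightedVoronoi π) (hπ : G.IsWeightedDelaunay π)
    (hG : G.IsTorusGraph) (H : IsRegularEnvelope G.cover.pos (G.lift π)) :
    S.cover.IsEmbedding where
  pos_injective F F' h := by
    have hS' := hS.isHullDual hπ hG H
    refine Subtype.ext ?_
    change S.pos F = S.pos F' at h
    rw [(hS' F).2, (hS' F').2, h]
  vertex_notMem F b hmem := by
    have h1 := (hS.isHullDual hπ hG H F).1
    have h2 := hS.active_eq_of_mem_openEdge hπ hG hmem
    change active G.cover.pos (G.lift π) (S.pos F) = _ at h2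
    rw [h2, ncard_pair (hG.tail_ne_head b)] at h1
    exact lt_irrefl _ h1
  edge_disjoint := by
    rintro b b' ⟨x, hx, hx'⟩
    exact hG.eq_or_eq_rev ((hS.active_eq_of_mem_openEdge hπ hG hx).symm.trans
      (hS.active_eq_of_mem_openEdge hπ hG hx'))

theorem mem_compl_support_iff (hS : S.IsWeightedVoronoi π) (hπ : G.IsWeightedDelaunay π)
    (hG : G.IsTorusGraph) (H : IsRegularEnvelope G.cover.pos (G.lift π)) (x : Plane) :
    x ∈ S.cover.supportᶜ ↔ ∃ a, active G.cover.pos (G.lift π) x = {a} := by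
  have hsupp : S.cover.support = ⋃ b, S.cover.edge b := by
    refine union_eq_right.2 ?_
    rintro _ ⟨F, rfl⟩
    rw [hS.skeleton]
    obtain ⟨a, ha, c, hc, hac⟩ := (one_lt_ncard (H.finite _)).1
      (one_lt_two.trans (hS.isHullDual hπ hG H F).1)
    exact ⟨a, c, hac, (G.mem_cell_iff π).2 ha, (G.mem_cell_iff π).2 hc⟩
  rw [hsupp, hS.skeleton]
  constructor
  · intro hx
    obtain ⟨a, ha⟩ := H.nonempty x
    refine ⟨a, Subset.antisymm (fun c hc => ?_) (singleton_subset_iff.2 ha)⟩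
    by_contra hca
    exact hx ⟨c, a, hca, (G.mem_cell_iff π).2 hc, (G.mem_cell_iff π).2 ha⟩
  · rintro ⟨a, ha⟩ ⟨c, d, hcd, hc, hd⟩
    rw [mem_cell_iff, ha] at hc hd
    exact hcd (hc.trans hd.symm)

theorem isCellular (hS : S.IsWeightedVoronoi π) (hπ : G.IsWeightedDelaunay π)
    (hG : G.IsTorusGraph) (H : IsRegularEnvelope G.cover.pos (G.lift π)) :
    S.cover.IsCellular M := by
  rintro F ⟨x, hx, rfl⟩
  obtain ⟨⟨v, j⟩, ha⟩ := (hS.mem_compl_support_iff hπ hG H x).1 hx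
  rw [H.connectedComponentIn_active_eq (hS.mem_compl_support_iff hπ hG H) ha]
  refine ⟨nonempty_homeomorph_ball (convex_setOf_active_eq _) ⟨x, ha⟩ (H.isOpen_setOf_active_eq _)
    (H.isBounded_setOf_active_eq _), fun k hk => ?_⟩
  have h1 : x + period M k ∈ {x | active G.cover.pos (G.lift π) x = {(v, j)}} := by
    rw [← hk]
    exact ⟨x, ha, rfl⟩
  -- Translation by `k` carries the cell of `(v, j)` to that of `(v, j + k)`, so a cell preserved by
  -- it forces `k = 0`.
  have h2 : (v, j + k) ∈ active G.cover.pos (G.lift π) (x + period M k) := by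
    rw [← mem_cell_iff, mem_cell_add_period, mem_cell_iff, ha]
    rfl
  rw [show active G.cover.pos (G.lift π) (x + period M k) = {(v, j)} from h1] at h2
  simpa using h2

end IsWeightedVoronoi

end DualDrawing

end GeodesicDrawing

end FlatTorus

theorem lemmaL (M : Matrix (Fin 2) (Fin 2) ℝ) (hM : M.det ≠ 0)
    {V D : Type*} [Finite V] [Finite D]
    (G : FlatTorus.GeodesicDrawing M V D) (hG : G.IsTorusGraph) :
    (∀ π : V → ℝ, G.IsWeightedDelaunay π →
      (∃! S : G.DualDrawing, S.IsWeightedVoronoi π) ∧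
      ∀ S : G.DualDrawing, S.IsWeightedVoronoi π → S.IsDualEmbedding ∧ S.IsOrthogonal) ∧
    (G.IsCoherent → G.IsReciprocal) := by
  have main : ∀ π : V → ℝ, G.IsWeightedDelaunay π →
      (∃! S : G.DualDrawing, S.IsWeightedVoronoi π) ∧
      ∀ S : G.DualDrawing, S.IsWeightedVoronoi π → S.IsDualEmbedding ∧ S.IsOrthogonal := by
    intro π hπ
    have hV := hG.nonempty
    have H := hπ.isRegularEnvelope hM
    obtain ⟨S, hS⟩ := FlatTorus.GeodesicDrawing.DualDrawing.exists_isHullDual G π hπ hG H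
    exact ⟨⟨S, hS.isWeightedVoronoi hπ hG H, fun S' hS' => hS.eq (hS'.isHullDual hπ hG H)⟩,
      fun S' hS' => ⟨⟨hS'.isEmbedding hπ hG H, hS'.isCellular hπ hG H⟩, hS'.isOrthogonal⟩⟩
  refine ⟨main, ?_⟩
  rintro ⟨π, hπ⟩
  obtain ⟨⟨S, hS, -⟩, h⟩ := main π hπ
  exact ⟨S, h S hS⟩
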